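/- **Conventions.** For a commutative ring $R$, let $W_{\mathrm{rat}}(R)$ be the set of rational functions $f=P/Q\in R[[t]]$ with $P,Q\in R[t]$, $P(0)=1=Q(0)$. It is a commutative ring: addition is the multiplication of rational functions, and the product is the bi-additive operation with $\det(1-tA)\cdot\det(1-tB)=\det(1-t\,A\otimes B)$ for square matrices $A,B$ over $R$. Let $[\,r\,]=1-rt$ be the Teichmüller map and, for $\nu\ge 1$, let $F_\nu$ be the ring endomorphism of $W_{\mathrm{rat}}(R)$ with $F_\nu(\det(1-tA))=\det(1-tA^\nu)$. For a scheme $X$, let $W_{\mathrm{rat}}(\mathcal O_X)$ be the sheaf associated to $U\mapsto W_{\mathrm{rat}}(\mathcal O_X(U))$ and let $W_{\mathrm{rat}}(X)$ be the ringed space $(X_{\mathrm{top}},W_{\mathrm{rat}}(\mathcal O_X))$. For a scheme $S$, a point $P\in W_{\mathrm{rat}}(X)(S)$ is a morphism of ringed spaces $P:S\to W_{\mathrm{rat}}(X)$ such that, for every $s\in S$, the composite $W_{\mathrm{rat}}(\mathcal O_X)_{P(s)}=W_{\mathrm{rat}}(\mathcal O_{X,P(s)})\to\mathcal O_{S,s}\to\kappa(s)$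 factors through a (necessarily unique) ring homomorphism $\tilde P_s:W_{\mathrm{rat}}(\kappa(P(s)))\to\kappa(s)$. Morphisms $W_{\mathrm{rat}}(Y)\to W_{\mathrm{rat}}(X)$ are defined in the same way; $W_{\mathrm{rat}}(X)$ is functorial in $X$. Write $W_{\mathrm{rat}}(X)(\mathbb C)$ for $S=\operatorname{Spec}\mathbb C$. The multiplicative monoid $\mathcal N$ of positive integers acts on $W_{\mathrm{rat}}(X)(S)$ via the endomorphisms $F_\nu$ of $W_{\mathrm{rat}}(X)$. **Theorem 4.1.** Let $\mathfrak X_0$ be an integral normal scheme (all local rings are integrally closed domains) with function field $K_0$, let $K$ be an algebraic closure of $K_0$, let $\pi:\mathfrak X\to\mathfrak X_0$ be the normalization of $\mathfrak X_0$ in $K$, and let $G=\mathrm{Aut}(K/K_0)$. Let $$\mathcal P=\{(\mathfrak x,\chi)\mid \mathfrak x\in\mathfrak X,\ \chi\in\mathrm{Hom}(\kappa(\mathfrak x)^\times,\mathbb C^\times)\}.$$ Let $\sigma\in G$ act on $\mathcal P$ from the right by $(\mathfrak x,\chi)^\sigma=(\mathfrak x^\sigma,\chi\circ\sigma)$, where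 $\mathfrak x\mapsto\mathfrak x^\sigma$ is the automorphism $\operatorname{Spec}(\sigma)$ of $\mathfrak X$ over $\mathfrak X_0$ induced by $\sigma$ and $\sigma:\kappa(\mathfrak x^\sigma)\to\kappa(\mathfrak x)$ is the induced isomorphism. Let $\nu\in\mathcal N$ act $G$-equivariantly by $F_\nu(\mathfrak x,\chi)=(\mathfrak x,\chi\circ(\;)^\nu)$. Then there is an $\mathcal N$-equivariant bijection $$\Phi:\ W_{\mathrm{rat}}(\mathfrak X_0)(\mathbb C)\ \xrightarrow{\ \sim\ }\ \mathcal P/G$$ which is natural in the following sense. The map $\varepsilon: W_{\mathrm{rat}}(\mathfrak X)(\mathbb C)\to\mathcal P$ sending $Q$ to $(\mathfrak x,\ a\mapsto\tilde Q([a]))$, with $\mathfrak x$ the image point of $Q$, is bijective, and for every $Q\in W_{\mathrm{rat}}(\mathfrak X)(\mathbb C)$ the image under $\Phi$ of the composite $W_{\mathrm{rat}}(\pi)\circ Q\in W_{\mathrm{rat}}(\mathfrak X_0)(\mathbb C)$ is the $G$-orbit of $\varepsilon(Q)$. (These properties determine $\Phi$ uniquely.) -/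

import Mathlib

open CategoryTheory Opposite TopologicalSpace AlgebraicGeometry
open scoped Polynomial PowerSeries Kronecker

universe u

noncomputable section

/-! ### Rational Witt vectors of a commutative ring -/

/-- The group of rational functions `P / Q ∈ R⟦t⟧` with `P, Q ∈ R[t]` and `P(0) = 1 = Q(0)`, under
multiplication (written additively). Such power series are units. -/
def ratWittSubgroup (R : Type u) [CommRing R] : AddSubgroup (Additive (R⟦X⟧)ˣ) where
  carrier := {f | ∃ P Q : R[X], P.coeff 0 = 1 ∧ Q.coeff 0 = 1 ∧
    ((f.toMul : (R⟦X⟧)ˣ) : R⟦X⟧) * (Q : R⟦X⟧) = (P : R⟦X⟧)}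
  zero_mem' := ⟨1, 1, by simp, by simp, by simp⟩
  add_mem' := by
    rintro f g ⟨P, Q, hP, hQ, h⟩ ⟨P', Q', hP', hQ', h'⟩
    refine ⟨P * P', Q * Q', by simp [Polynomial.mul_coeff_zero, hP, hP'],
      by simp [Polynomial.mul_coeff_zero, hQ, hQ'], ?_⟩
    rw [Polynomial.coe_mul, Polynomial.coe_mul, ← h, ← h']
    simp only [toMul_add, Units.val_mul]
    ring
  neg_mem' := by
    rintro f ⟨P, Q, hP, hQ, h⟩
    refine ⟨Q, P, hQ, hP, ?_⟩
    rw [← h, toMul_neg, Units.inv_mul_cancel_left]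

/-- The rational Witt vectors `W_rat(R)`: as a set, the rational functions `f = P / Q` in `R⟦t⟧`
with `P, Q ∈ R[t]`, `P(0) = 1 = Q(0)`. Addition is multiplication of rational functions. -/
def RatWitt (R : Type u) [CommRing R] : Type u := ratWittSubgroup R

namespace RatWitt

section Basic

variable {R : Type u} [CommRing R]

instance : AddCommGroup (RatWitt R) := inferInstanceAs (AddCommGroup (ratWittSubgroup R))

/-- The power series underlying a rational Witt vector. -/
def series (f : RatWitt R) : R⟦X⟧ := ((f.1.toMul : (R⟦X⟧)ˣ) : R⟦X⟧)

@[ext]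
theorem ext {f g : RatWitt R} (h : f.series = g.series) : f = g :=
  Subtype.ext (Additive.toMul.injective (Units.ext h))

@[simp] theorem series_zero : (0 : RatWitt R).series = 1 := rfl

@[simp] theorem series_add (f g : RatWitt R) : (f + g).series = f.series * g.series := rfl

theorem isUnit_series (f : RatWitt R) : IsUnit f.series := Units.isUnit _

/-- A polynomial with constant coefficient `1`, as a rational Witt vector. -/
def ofPoly (P : R[X]) (hP : P.coeff 0 = 1) : RatWitt R :=
  ⟨Additive.ofMul (IsUnit.unit (a := (P : R⟦X⟧))
    (PowerSeries.isUnit_iff_constantCoeff.mpr (by simp [hP]))), P, 1, hP, by simp, by simp⟩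

@[simp] theorem series_ofPoly (P : R[X]) (hP : P.coeff 0 = 1) : (ofPoly P hP).series = P := rfl

theorem exists_ofPoly (f : RatWitt R) : ∃ P Q : R[X], ∃ (hP : P.coeff 0 = 1) (hQ : Q.coeff 0 = 1),
    f = ofPoly P hP - ofPoly Q hQ := by
  obtain ⟨P, Q, hP, hQ, h⟩ := f.2
  exact ⟨P, Q, hP, hQ, eq_sub_of_add_eq (ext h)⟩

end Basic

section Matrix

variable {R : Type u} [CommRing R]
variable {m n m' n' : Type*} [Fintype m] [DecidableEq m] [Fintype n] [DecidableEq n]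
  [Fintype m'] [DecidableEq m'] [Fintype n'] [DecidableEq n']

/-- The class of a square matrix `A`: the polynomial `det (1 - t A)`. -/
def cls (A : Matrix n n R) : RatWitt R :=
  ofPoly A.charpolyRev (by rw [Polynomial.coeff_zero_eq_eval_zero, Matrix.eval_charpolyRev])

@[simp] theorem series_cls (A : Matrix n n R) : (cls A).series = (A.charpolyRev : R⟦X⟧) := rfl

theorem cls_eq_iff {A : Matrix n n R} {B : Matrix m m R} :
    cls A = cls B ↔ A.charpolyRev = B.charpolyRev :=
  ⟨fun h => Polynomial.coe_injective R (congrArg series h), fun h => ext (by simp [h])⟩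

theorem charpolyRev_reindex (e : m ≃ n) (A : Matrix m m R) :
    (A.reindex e e).charpolyRev = A.charpolyRev := by
  unfold Matrix.charpolyRev
  rw [← Matrix.det_reindex_self e]
  congr 1
  ext i j
  simp [Matrix.one_apply]

theorem cls_reindex (e : m ≃ n) (A : Matrix m m R) : cls (A.reindex e e) = cls A :=
  cls_eq_iff.mpr (charpolyRev_reindex e A)

theorem cls_fromBlocks (A : Matrix m m R) (B : Matrix n n R) :
    cls (Matrix.fromBlocks A 0 0 B) = cls A + cls B := by
  apply ext
  rw [series_add, series_cls, series_cls, series_cls, ← Polynomial.coe_mul]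
  congr 1
  unfold Matrix.charpolyRev
  rw [← Matrix.det_fromBlocks_zero₂₁ _ (0 : Matrix m n R[X])]
  congr 1
  rw [← Matrix.fromBlocks_one, Matrix.fromBlocks_map, Matrix.fromBlocks_smul]
  ext (i | i) (j | j) <;> simp [Matrix.one_apply]

/-- Silvester's determinant formula gives `det (1 - t A ⊗ B) = det (Q (t A))`
for `Q = det (1 - t B)`. -/
theorem charpolyRev_kronecker (A : Matrix m m R) (B : Matrix n n R) :
    (A ⊗ₖ B).charpolyRev =
      (B.charpolyRev.eval₂ ((Matrix.scalar m).comp Polynomial.C)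
        ((Polynomial.X : R[X]) • A.map Polynomial.C)).det := by
  let s : Matrix m m R[X] := (Polynomial.X : R[X]) • A.map Polynomial.C
  have hc : ∀ r, Commute (((Matrix.scalar m).comp Polynomial.C) r) s := fun r =>
    Matrix.scalar_commute _ (fun r' => Commute.all _ _) _
  let F : R[X] →+* Matrix m m R[X] :=
    Polynomial.eval₂RingHom' ((Matrix.scalar m).comp Polynomial.C) s hc
  have h := Matrix.det_det (1 - (Polynomial.X : R[X]) • B.map Polynomial.C) F
  change _ = (F B.charpolyRev).det
  unfold Matrix.charpolyRev
  rw [h, ← Matrix.det_reindex_self (Equiv.prodComm m n)]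
  congr 1
  ext ⟨i, k⟩ ⟨j, l⟩
  have hX : F Polynomial.X = s := Polynomial.eval₂_X _ _
  have hC : ∀ r, F (Polynomial.C r) = Matrix.scalar m (Polynomial.C r) :=
    fun r => Polynomial.eval₂_C _ _
  by_cases hij : i = j <;> by_cases hkl : k = l <;>
    simp [Matrix.comp_apply, hX, hC, hij, hkl, s, Matrix.kroneckerMap_apply, Matrix.scalar_apply] <;>
    exact congrArg (Polynomial.coeff · _) (by ring)

theorem cls_kronecker_comm (A : Matrix m m R) (B : Matrix n n R) :
    cls (A ⊗ₖ B) = cls (B ⊗ₖ A) := by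
  rw [← cls_reindex (Equiv.prodComm m n) (A ⊗ₖ B)]
  congr 1
  ext ⟨i, k⟩ ⟨j, l⟩
  simp [mul_comm]

theorem cls_kronecker_congr {A : Matrix m m R} {A' : Matrix m' m' R} {B : Matrix n n R}
    {B' : Matrix n' n' R} (hA : cls A = cls A') (hB : cls B = cls B') :
    cls (A ⊗ₖ B) = cls (A' ⊗ₖ B') := by
  have key : ∀ {k l l' : Type _} [Fintype k] [DecidableEq k] [Fintype l] [DecidableEq l]
      [Fintype l'] [DecidableEq l'] (A : Matrix k k R) (B : Matrix l l R) (B' : Matrix l' l' R),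
      cls B = cls B' → cls (A ⊗ₖ B) = cls (A ⊗ₖ B') := by
    intro k l l' _ _ _ _ _ _ A B B' h
    rw [cls_eq_iff] at h ⊢
    rw [charpolyRev_kronecker, charpolyRev_kronecker, h]
  have key2 : ∀ {k l l' : Type _} [Fintype k] [DecidableEq k] [Fintype l] [DecidableEq l]
      [Fintype l'] [DecidableEq l'] (A : Matrix k k R) (B : Matrix l l R) (B' : Matrix l' l' R),
      cls B = cls B' → cls (A ⊗ₖ B) = cls (A ⊗ₖ B') := by
    intro k l l' _ _ _ _ _ _ A B B' h
    rw [cls_eq_iff] at h ⊢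
    rw [charpolyRev_kronecker, charpolyRev_kronecker, h]
  rw [key A B B' hB, cls_kronecker_comm, key2 B' A A' hA, cls_kronecker_comm]

theorem cls_kronecker_fromBlocks (A : Matrix m m R) (B : Matrix n n R) (C : Matrix m' m' R) :
    cls (C ⊗ₖ Matrix.fromBlocks A 0 0 B) = cls (C ⊗ₖ A) + cls (C ⊗ₖ B) := by
  rw [← cls_fromBlocks, ← cls_reindex (Equiv.prodSumDistrib m' m n)]
  congr 1
  ext (⟨i, k⟩ | ⟨i, k⟩) (⟨j, l⟩ | ⟨j, l⟩) <;> simp [Equiv.prodSumDistrib]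

theorem exists_charpolyRev (P : R[X]) (hP : P.coeff 0 = 1) :
    ∃ (n : ℕ) (A : Matrix (Fin n) (Fin n) R), A.charpolyRev = P := by
  nontriviality R
  have hg : P.reverse.Monic := by
    rw [Polynomial.Monic, Polynomial.reverse_leadingCoeff, Polynomial.trailingCoeff,
      Polynomial.natTrailingDegree_eq_zero.mpr (Or.inr (by simp [hP])), hP]
  let pb := AdjoinRoot.powerBasis' hg
  let A := Algebra.leftMulMatrix pb.basis pb.gen
  have h0 : Polynomial.aeval pb.gen A.charpoly = 0 := by
    apply Algebra.leftMulMatrix_injective pb.basis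
    rw [← Polynomial.aeval_algHom_apply, Matrix.aeval_self_charpoly, map_zero]
  have h1 : P.reverse ∣ A.charpoly := by
    rw [← AdjoinRoot.mk_eq_zero, ← AdjoinRoot.aeval_eq]
    exact h0
  have h2 : A.charpoly = P.reverse := by
    refine (Polynomial.eq_of_monic_of_dvd_of_natDegree_le hg A.charpoly_monic h1 ?_)
    rw [Matrix.charpoly_natDegree_eq_dim, Fintype.card_fin]
    exact le_of_eq (AdjoinRoot.powerBasis'_dim hg)
  refine ⟨pb.dim, A, ?_⟩
  rw [← Matrix.reverse_charpoly, h2]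
  have h3 : P.reverse.natDegree = P.natDegree := by
    rw [Polynomial.reverse_natDegree, Polynomial.natTrailingDegree_eq_zero.mpr
      (Or.inr (by simp [hP])), Nat.sub_zero]
  rw [Polynomial.reverse, h3, Polynomial.reverse, Polynomial.reflect_reflect]

end Matrix

section Ring

variable {R : Type u} [CommRing R]
variable {m n : Type*} [Fintype m] [DecidableEq m] [Fintype n] [DecidableEq n]

theorem exists_cls (f : RatWitt R) : ∃ (k l : ℕ) (A : Matrix (Fin k) (Fin k) R)
    (B : Matrix (Fin l) (Fin l) R), f = cls A - cls B := by
  obtain ⟨P, Q, hP, hQ, rfl⟩ := exists_ofPoly f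
  obtain ⟨k, A, rfl⟩ := exists_charpolyRev P hP
  obtain ⟨l, B, rfl⟩ := exists_charpolyRev Q hQ
  exact ⟨k, l, A, B, rfl⟩

theorem cls_kronecker_fromBlocks' (A : Matrix m m R) (B : Matrix n n R) {k : Type*} [Fintype k]
    [DecidableEq k] (C : Matrix k k R) :
    cls (Matrix.fromBlocks A 0 0 B ⊗ₖ C) = cls (A ⊗ₖ C) + cls (B ⊗ₖ C) := by
  rw [cls_kronecker_comm, cls_kronecker_fromBlocks, cls_kronecker_comm C, cls_kronecker_comm C]

/-- The size of a chosen matrix in the numerator of `f`. -/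
def numSize (f : RatWitt R) : ℕ := (exists_cls f).choose

/-- The size of a chosen matrix in the denominator of `f`. -/
def denSize (f : RatWitt R) : ℕ := (exists_cls f).choose_spec.choose

/-- A chosen matrix `A` in a representation `f = det (1 - t A) / det (1 - t B)`. -/
def num (f : RatWitt R) : Matrix (Fin f.numSize) (Fin f.numSize) R :=
  (exists_cls f).choose_spec.choose_spec.choose

/-- A chosen matrix `B` in a representation `f = det (1 - t A) / det (1 - t B)`. -/
def den (f : RatWitt R) : Matrix (Fin f.denSize) (Fin f.denSize) R :=
  (exists_cls f).choose_spec.choose_spec.choose_spec.choose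

theorem cls_num_sub_cls_den (f : RatWitt R) : cls f.num - cls f.den = f :=
  (exists_cls f).choose_spec.choose_spec.choose_spec.choose_spec.symm

/-- The product of `det (1 - t A) / det (1 - t B)` and `det (1 - t A') / det (1 - t B')` is
`det (1 - t A ⊗ A') det (1 - t B ⊗ B') / (det (1 - t A ⊗ B') det (1 - t B ⊗ A'))`. By
`cls_sub_mul_cls_sub` it does not depend on the chosen matrices. -/
instance : Mul (RatWitt R) where
  mul f g := cls (f.num ⊗ₖ g.num) + cls (f.den ⊗ₖ g.den)
    - (cls (f.num ⊗ₖ g.den) + cls (f.den ⊗ₖ g.num))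

theorem kronecker_aux {a a' b b' k : Type*} [Fintype a] [DecidableEq a] [Fintype a']
    [DecidableEq a'] [Fintype b] [DecidableEq b] [Fintype b'] [DecidableEq b'] [Fintype k]
    [DecidableEq k] {A : Matrix a a R} {B : Matrix b b R} {A' : Matrix a' a' R}
    {B' : Matrix b' b' R} (h : cls A - cls B = cls A' - cls B') (C : Matrix k k R) :
    cls (A ⊗ₖ C) - cls (B ⊗ₖ C) = cls (A' ⊗ₖ C) - cls (B' ⊗ₖ C) := by
  rw [sub_eq_sub_iff_add_eq_add] at h ⊢
  rw [← cls_fromBlocks, ← cls_fromBlocks] at h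
  rw [← cls_kronecker_fromBlocks', ← cls_kronecker_fromBlocks']
  exact cls_kronecker_congr h rfl

theorem cls_sub_mul_cls_sub {a a' b b' : Type*} [Fintype a] [DecidableEq a] [Fintype a']
    [DecidableEq a'] [Fintype b] [DecidableEq b] [Fintype b'] [DecidableEq b']
    (A : Matrix a a R) (B : Matrix b b R) (A' : Matrix a' a' R) (B' : Matrix b' b' R) :
    (cls A - cls B) * (cls A' - cls B') =
      cls (A ⊗ₖ A') + cls (B ⊗ₖ B') - (cls (A ⊗ₖ B') + cls (B ⊗ₖ A')) := by
  set f := cls A - cls B with hf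
  set g := cls A' - cls B' with hg
  have e1 := kronecker_aux ((cls_num_sub_cls_den f).trans hf) g.num
  have e2 := kronecker_aux ((cls_num_sub_cls_den f).trans hf) g.den
  have e3 := kronecker_aux ((cls_num_sub_cls_den g).trans hg) A
  have e4 := kronecker_aux ((cls_num_sub_cls_den g).trans hg) B
  rw [cls_kronecker_comm _ A, cls_kronecker_comm _ A, cls_kronecker_comm _ A,
    cls_kronecker_comm _ A] at e3
  rw [cls_kronecker_comm _ B, cls_kronecker_comm _ B, cls_kronecker_comm _ B,
    cls_kronecker_comm _ B] at e4
  change cls (f.num ⊗ₖ g.num) + cls (f.den ⊗ₖ g.den)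
    - (cls (f.num ⊗ₖ g.den) + cls (f.den ⊗ₖ g.num)) = _
  calc _ = (cls (f.num ⊗ₖ g.num) - cls (f.den ⊗ₖ g.num))
        - (cls (f.num ⊗ₖ g.den) - cls (f.den ⊗ₖ g.den)) := by abel
    _ = (cls (A ⊗ₖ g.num) - cls (A ⊗ₖ g.den)) - (cls (B ⊗ₖ g.num) - cls (B ⊗ₖ g.den)) := by
        rw [e1, e2]; abel
    _ = _ := by rw [e3, e4]; abel

theorem cls_isEmpty [IsEmpty n] (A : Matrix n n R) : cls A = 0 :=
  ext (by simp [Matrix.charpolyRev])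

/-- In particular `det (1 - t A) * det (1 - t B) = det (1 - t A ⊗ B)`. -/
theorem cls_mul_cls (A : Matrix m m R) (B : Matrix n n R) : cls A * cls B = cls (A ⊗ₖ B) := by
  have h := cls_sub_mul_cls_sub A (0 : Matrix (Fin 0) (Fin 0) R) B (0 : Matrix (Fin 0) (Fin 0) R)
  simpa [cls_isEmpty] using h

instance : One (RatWitt R) := ⟨cls (1 : Matrix Unit Unit R)⟩

theorem one_def : (1 : RatWitt R) = cls (1 : Matrix Unit Unit R) := rfl

protected theorem mul_comm (f g : RatWitt R) : f * g = g * f := by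
  obtain ⟨k, l, A, B, rfl⟩ := exists_cls f
  obtain ⟨k', l', A', B', rfl⟩ := exists_cls g
  rw [cls_sub_mul_cls_sub, cls_sub_mul_cls_sub, cls_kronecker_comm A', cls_kronecker_comm B',
    cls_kronecker_comm A', cls_kronecker_comm B']
  abel

protected theorem mul_add (f g h : RatWitt R) : f * (g + h) = f * g + f * h := by
  obtain ⟨k, l, A, B, rfl⟩ := exists_cls f
  obtain ⟨k', l', A', B', rfl⟩ := exists_cls g
  obtain ⟨k'', l'', A'', B'', rfl⟩ := exists_cls h
  have e : cls A' - cls B' + (cls A'' - cls B'') =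
      cls (Matrix.fromBlocks A' 0 0 A'') - cls (Matrix.fromBlocks B' 0 0 B'') := by
    rw [cls_fromBlocks, cls_fromBlocks]; abel
  rw [e, cls_sub_mul_cls_sub, cls_sub_mul_cls_sub, cls_sub_mul_cls_sub]
  simp only [cls_kronecker_fromBlocks]
  abel

theorem cls_kronecker_assoc {k : Type*} [Fintype k] [DecidableEq k] (A : Matrix m m R)
    (B : Matrix n n R) (C : Matrix k k R) : cls (A ⊗ₖ B ⊗ₖ C) = cls (A ⊗ₖ (B ⊗ₖ C)) := by
  rw [← cls_reindex (Equiv.prodAssoc m n k)]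
  congr 1
  ext ⟨i, i', i''⟩ ⟨j, j', j''⟩
  simp [mul_assoc]

protected theorem sub_mul (f g h : RatWitt R) : (f - g) * h = f * h - g * h := by
  rw [eq_sub_iff_add_eq, RatWitt.mul_comm, RatWitt.mul_comm g, ← RatWitt.mul_add, sub_add_cancel,
    RatWitt.mul_comm]

protected theorem mul_sub (f g h : RatWitt R) : f * (g - h) = f * g - f * h := by
  rw [RatWitt.mul_comm, RatWitt.sub_mul, RatWitt.mul_comm g, RatWitt.mul_comm h]

protected theorem mul_assoc (f g h : RatWitt R) : f * g * h = f * (g * h) := by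
  obtain ⟨k, l, A, B, rfl⟩ := exists_cls f
  obtain ⟨k', l', A', B', rfl⟩ := exists_cls g
  obtain ⟨k'', l'', A'', B'', rfl⟩ := exists_cls h
  simp only [RatWitt.sub_mul, RatWitt.mul_sub, cls_mul_cls, cls_kronecker_assoc]

protected theorem one_mul (f : RatWitt R) : 1 * f = f := by
  obtain ⟨k, l, A, B, rfl⟩ := exists_cls f
  have e : ∀ (k : ℕ) (A : Matrix (Fin k) (Fin k) R), cls ((1 : Matrix Unit Unit R) ⊗ₖ A) = cls A := by
    intro k A
    rw [← cls_reindex (Equiv.punitProd (Fin k))]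
    congr 1
    ext i j
    simp [Matrix.kroneckerMap_apply]
  rw [RatWitt.mul_sub, one_def, cls_mul_cls, cls_mul_cls, e, e]

instance : CommRing (RatWitt R) :=
  { (inferInstance : AddCommGroup (RatWitt R)) with
    mul := (· * ·)
    one := 1
    mul_assoc := RatWitt.mul_assoc
    one_mul := RatWitt.one_mul
    mul_one := fun f => by rw [RatWitt.mul_comm]; exact RatWitt.one_mul f
    mul_comm := RatWitt.mul_comm
    left_distrib := RatWitt.mul_add
    right_distrib := fun f g h => by
      rw [RatWitt.mul_comm, RatWitt.mul_add, RatWitt.mul_comm h, RatWitt.mul_comm h]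
    zero_mul := fun f => by simpa using RatWitt.sub_mul f f f
    mul_zero := fun f => by simpa using RatWitt.mul_sub f f f }

/-- The Teichmüller map `[r] = 1 - r t`. -/
def teichmuller : R →* RatWitt R where
  toFun r := cls (Matrix.of fun _ _ : Unit => r)
  map_one' := by
    rw [one_def]
    congr 1
  map_mul' r s := by
    rw [cls_mul_cls, ← cls_reindex (Equiv.prodPUnit Unit)]
    congr 1

theorem series_teichmuller (r : R) :
    (teichmuller r).series = 1 - PowerSeries.C r * PowerSeries.X := by
  change ((Matrix.charpolyRev (Matrix.of fun _ _ : Unit => r) : R[X]) : R⟦X⟧) = _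
  simp only [Matrix.charpolyRev, Matrix.det_unique]
  simp [PowerSeries.commute_X (PowerSeries.C r) |>.eq]

end Ring

section Functoriality

variable {R S T : Type u} [CommRing R] [CommRing S] [CommRing T]
variable {m n : Type*} [Fintype m] [DecidableEq m] [Fintype n] [DecidableEq n]

/-- The additive map `W_rat(R) → W_rat(S)` induced by a ring homomorphism `R → S`, applied to the
coefficients of a rational function. -/
def mapFun (f : R →+* S) (w : RatWitt R) : RatWitt S :=
  ⟨Additive.ofMul (Units.map (PowerSeries.map f).toMonoidHom w.1.toMul), by
    obtain ⟨P, Q, hP, hQ, h⟩ := w.2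
    refine ⟨P.map f, Q.map f, by simp [hP], by simp [hQ], ?_⟩
    have h' := congrArg (PowerSeries.map f) h
    rw [map_mul, ← Polynomial.polynomial_map_coe, ← Polynomial.polynomial_map_coe] at h'
    exact h'⟩

theorem series_mapFun (f : R →+* S) (w : RatWitt R) :
    (mapFun f w).series = PowerSeries.map f w.series := rfl

theorem charpolyRev_map (f : R →+* S) (A : Matrix n n R) :
    (A.map f).charpolyRev = A.charpolyRev.map f := by
  unfold Matrix.charpolyRev
  rw [← Polynomial.coe_mapRingHom, RingHom.map_det]
  congr 1
  ext i j
  by_cases h : i = j <;> simp [h]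

theorem mapFun_cls (f : R →+* S) (A : Matrix n n R) : mapFun f (cls A) = cls (A.map f) :=
  ext (by rw [series_mapFun, series_cls, series_cls, charpolyRev_map, Polynomial.polynomial_map_coe])

theorem mapFun_add (f : R →+* S) (v w : RatWitt R) : mapFun f (v + w) = mapFun f v + mapFun f w :=
  ext (by simp [series_mapFun])

/-- The ring homomorphism `W_rat(R) → W_rat(S)` induced by a ring homomorphism `R → S`. -/
def map (f : R →+* S) : RatWitt R →+* RatWitt S where
  toFun := mapFun f
  map_zero' := ext (by simp [series_mapFun])
  map_add' := mapFun_add f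
  map_one' := by
    rw [one_def, mapFun_cls, one_def]
    congr 1
    ext i j
    simp
  map_mul' v w := by
    have hs : ∀ v w : RatWitt R, mapFun f (v - w) = mapFun f v - mapFun f w := fun v w => by
      rw [eq_sub_iff_add_eq, ← mapFun_add, sub_add_cancel]
    obtain ⟨k, l, A, B, rfl⟩ := exists_cls v
    obtain ⟨k', l', A', B', rfl⟩ := exists_cls w
    have e : ∀ {a b : ℕ} (A : Matrix (Fin a) (Fin a) R) (B : Matrix (Fin b) (Fin b) R),
        mapFun f (cls (A ⊗ₖ B)) = cls (A.map f) * cls (B.map f) := by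
      intro a b A B
      rw [mapFun_cls, cls_mul_cls]
      congr 1
      ext i j
      simp
    simp only [sub_mul, mul_sub, cls_mul_cls, hs, e]
    simp only [mapFun_cls, cls_mul_cls]

@[simp] theorem series_map (f : R →+* S) (w : RatWitt R) :
    (map f w).series = PowerSeries.map f w.series := rfl

theorem map_cls (f : R →+* S) (A : Matrix n n R) : map f (cls A) = cls (A.map f) := mapFun_cls f A

theorem map_teichmuller (f : R →+* S) (r : R) : map f (teichmuller r) = teichmuller (f r) :=
  map_cls f _

theorem map_id : map (RingHom.id R) = RingHom.id (RatWitt R) :=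
  RingHom.ext fun w => ext (by simp)

theorem map_comp (g : S →+* T) (f : R →+* S) : map (g.comp f) = (map g).comp (map f) :=
  RingHom.ext fun w => ext (by simp [PowerSeries.map_comp])

end Functoriality

section Frobenius

variable {R S : Type u} [CommRing R] [CommRing S]
variable {m n : Type*} [Fintype m] [DecidableEq m] [Fintype n] [DecidableEq n]

theorem expand_charpolyRev_pow (A : Matrix m m R) (ν : ℕ) (Z : Matrix n n R)
    (hZ : Z.charpolyRev = 1 - Polynomial.X ^ ν) :
    Polynomial.expand R ν (A ^ ν).charpolyRev = (A ⊗ₖ Z).charpolyRev := by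
  rw [charpolyRev_kronecker, hZ, Polynomial.eval₂_sub, Polynomial.eval₂_one,
    Polynomial.eval₂_X_pow, smul_pow]
  have e : (A.map Polynomial.C) ^ ν = (A ^ ν).map (Polynomial.C : R →+* R[X]) :=
    (map_pow (Polynomial.C : R →+* R[X]).mapMatrix A ν).symm
  rw [e]
  unfold Matrix.charpolyRev
  rw [AlgHom.map_det]
  congr 1
  ext i j
  by_cases h : i = j <;> simp [h]

theorem cls_pow_congr {A : Matrix m m R} {B : Matrix n n R} (h : cls A = cls B) {ν : ℕ}
    (hν : 0 < ν) : cls (A ^ ν) = cls (B ^ ν) := by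
  obtain ⟨k, Z, hZ⟩ := exists_charpolyRev (1 - Polynomial.X ^ ν : R[X]) (by
    simp [hν.ne])
  rw [cls_eq_iff]
  apply Polynomial.expand_injective hν
  rw [expand_charpolyRev_pow A ν Z hZ, expand_charpolyRev_pow B ν Z hZ]
  exact cls_eq_iff.mp (cls_kronecker_congr h rfl)

/-- The Frobenius `F_ν` sends `det (1 - t A) / det (1 - t B)` to `det (1 - t A^ν) / det (1 - t B^ν)`.
By `frobeniusFun_cls_sub_cls` it does not depend on the chosen matrices. -/
def frobeniusFun (ν : ℕ+) (w : RatWitt R) : RatWitt R :=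
  cls (w.num ^ (ν : ℕ)) - cls (w.den ^ (ν : ℕ))

theorem frobeniusFun_cls_sub_cls (ν : ℕ+) (A : Matrix m m R) (B : Matrix n n R) :
    frobeniusFun ν (cls A - cls B) = cls (A ^ (ν : ℕ)) - cls (B ^ (ν : ℕ)) := by
  have h := cls_num_sub_cls_den (cls A - cls B)
  rw [frobeniusFun]
  rw [sub_eq_sub_iff_add_eq_add] at h ⊢
  rw [← cls_fromBlocks, ← cls_fromBlocks] at h ⊢
  have h' := cls_pow_congr h ν.pos
  rwa [Matrix.fromBlocks_diagonal_pow, Matrix.fromBlocks_diagonal_pow] at h'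

theorem kronecker_pow (A : Matrix m m R) (B : Matrix n n R) (ν : ℕ) :
    (A ⊗ₖ B) ^ ν = (A ^ ν) ⊗ₖ (B ^ ν) := by
  induction ν with
  | zero => simp
  | succ k ih => rw [pow_succ, pow_succ, pow_succ, ih, Matrix.mul_kronecker_mul]

theorem frobeniusFun_cls (ν : ℕ+) (A : Matrix n n R) :
    frobeniusFun ν (cls A) = cls (A ^ (ν : ℕ)) := by
  have h := frobeniusFun_cls_sub_cls ν A (0 : Matrix (Fin 0) (Fin 0) R)
  rwa [cls_isEmpty (0 : Matrix (Fin 0) (Fin 0) R), cls_isEmpty ((0 : Matrix (Fin 0) (Fin 0) R) ^ _),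
    sub_zero, sub_zero] at h

theorem frobeniusFun_add (ν : ℕ+) (v w : RatWitt R) :
    frobeniusFun ν (v + w) = frobeniusFun ν v + frobeniusFun ν w := by
  obtain ⟨k, l, A, B, rfl⟩ := exists_cls v
  obtain ⟨k', l', A', B', rfl⟩ := exists_cls w
  have e : cls A - cls B + (cls A' - cls B') =
      cls (Matrix.fromBlocks A 0 0 A') - cls (Matrix.fromBlocks B 0 0 B') := by
    rw [cls_fromBlocks, cls_fromBlocks]; abel
  rw [e, frobeniusFun_cls_sub_cls, frobeniusFun_cls_sub_cls, frobeniusFun_cls_sub_cls,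
    Matrix.fromBlocks_diagonal_pow, Matrix.fromBlocks_diagonal_pow, cls_fromBlocks, cls_fromBlocks]
  abel

/-- The Frobenius endomorphism `F_ν` of the ring `W_rat(R)`. -/
def frobenius (ν : ℕ+) : RatWitt R →+* RatWitt R where
  toFun := frobeniusFun ν
  map_zero' := by
    have h := frobeniusFun_cls ν (0 : Matrix (Fin 0) (Fin 0) R)
    rwa [cls_isEmpty, cls_isEmpty] at h
  map_add' := frobeniusFun_add ν
  map_one' := by rw [one_def, frobeniusFun_cls, one_pow]
  map_mul' v w := by
    have hs : ∀ v w : RatWitt R, frobeniusFun ν (v - w) = frobeniusFun ν v - frobeniusFun ν w :=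
      fun v w => by rw [eq_sub_iff_add_eq, ← frobeniusFun_add, sub_add_cancel]
    obtain ⟨k, l, A, B, rfl⟩ := exists_cls v
    obtain ⟨k', l', A', B', rfl⟩ := exists_cls w
    simp only [sub_mul, mul_sub, cls_mul_cls, hs, frobeniusFun_cls, kronecker_pow]

theorem frobenius_cls (ν : ℕ+) (A : Matrix n n R) : frobenius ν (cls A) = cls (A ^ (ν : ℕ)) :=
  frobeniusFun_cls ν A

theorem frobenius_teichmuller (ν : ℕ+) (r : R) :
    frobenius ν (teichmuller r) = teichmuller (r ^ (ν : ℕ)) := by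
  have e : (Matrix.of fun _ _ : Unit => r) = Matrix.scalar Unit r := by ext i j; simp
  have e' : (Matrix.of fun _ _ : Unit => r ^ (ν : ℕ)) = Matrix.scalar Unit (r ^ (ν : ℕ)) := by
    ext i j; simp
  change frobenius ν (cls _) = cls _
  rw [frobenius_cls, e, e', map_pow]

theorem ringHom_ext {A : Type*} [Ring A] {φ ψ : RatWitt R →+* A}
    (h : ∀ (k : ℕ) (A : Matrix (Fin k) (Fin k) R), φ (cls A) = ψ (cls A)) : φ = ψ := by
  ext w
  obtain ⟨k, l, A, B, rfl⟩ := exists_cls w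
  rw [map_sub, map_sub, h, h]

theorem frobenius_one : frobenius (R := R) 1 = RingHom.id _ :=
  ringHom_ext fun k A => by simp [frobenius_cls]

theorem frobenius_mul (μ ν : ℕ+) :
    frobenius (R := R) (μ * ν) = (frobenius μ).comp (frobenius ν) :=
  ringHom_ext fun k A => by simp [frobenius_cls, ← pow_mul, mul_comm]

theorem map_comp_frobenius (f : R →+* S) (ν : ℕ+) :
    (map f).comp (frobenius ν) = (frobenius ν).comp (map f) :=
  ringHom_ext fun k A => by
    simp only [RingHom.comp_apply, frobenius_cls, map_cls]
    exact congrArg cls (map_pow f.mapMatrix A ν)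

end Frobenius

end RatWitt

/-! ### Rational Witt spaces -/

/-- The functor `R ↦ W_rat(R)`. -/
def ratWittFunctor : CommRingCat.{u} ⥤ CommRingCat.{u} where
  obj R := CommRingCat.of (RatWitt R)
  map f := CommRingCat.ofHom (RatWitt.map f.hom)
  map_id R := by ext1; exact RatWitt.map_id
  map_comp f g := by ext1; exact RatWitt.map_comp g.hom f.hom

/-- The Frobenius as a natural transformation. -/
def ratWittFrobenius (ν : ℕ+) : ratWittFunctor.{u} ⟶ ratWittFunctor where
  app R := CommRingCat.ofHom (RatWitt.frobenius ν)
  naturality R S f := by ext1; exact (RatWitt.map_comp_frobenius f.hom ν).symm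

/-- A ringed space with a chosen quotient ring `O_x → k(x)` of each stalk. -/
structure ResiduedSpace where
  /-- The underlying ringed space. -/
  space : SheafedSpace CommRingCat.{u}
  /-- The quotient `k(x)` of the stalk at `x`. -/
  residueRing : space → CommRingCat.{u}
  /-- The quotient map. -/
  residue : ∀ x : space, space.presheaf.stalk x ⟶ residueRing x
  residue_surjective : ∀ x : space, Function.Surjective (residue x).hom

namespace ResiduedSpace

/-- A morphism: a morphism of ringed spaces such that at each point `s` of the source the map
on stalks induces a ring homomorphism of the chosen quotients `k(f(s)) → k(s)`. -/
@[ext]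
structure Hom (S X : ResiduedSpace.{u}) where
  /-- The underlying morphism of ringed spaces. -/
  hom : S.space ⟶ X.space
  exists_residueMap : ∀ s : S.space, ∃ r : X.residueRing (hom.hom.base s) ⟶ S.residueRing s,
    hom.hom.stalkMap s ≫ S.residue s = X.residue (hom.hom.base s) ≫ r

instance : Category ResiduedSpace.{u} where
  Hom := Hom
  id X := ⟨𝟙 X.space, fun s => ⟨𝟙 _, by
    simp⟩⟩
  comp {S _ _} f g := ⟨f.hom ≫ g.hom, fun s => by
    obtain ⟨r, hr⟩ := f.exists_residueMap s
    obtain ⟨r', hr'⟩ := g.exists_residueMap (f.hom.hom.base s)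
    refine ⟨r' ≫ r, ?_⟩
    have e := PresheafedSpace.stalkMap.comp f.hom.hom g.hom.hom s
    calc _ = ((g.hom.hom.stalkMap (f.hom.hom.base s)) ≫ f.hom.hom.stalkMap s) ≫ S.residue s :=
          congrArg (· ≫ S.residue s) e
      _ = _ := by
        rw [Category.assoc, hr, ← Category.assoc, hr', Category.assoc]
        rfl⟩

/-- The map on underlying points. -/
def Hom.pt {S X : ResiduedSpace.{u}} (f : S ⟶ X) (s : S.space) : X.space :=
  (Hom.hom f).hom.base s

/-- The homomorphism `k(f(s)) → k(s)` induced by a morphism `f`. It is unique by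
`residueMap_unique`. -/
def Hom.residueMap {S X : ResiduedSpace.{u}} (f : S ⟶ X) (s : S.space) :
    X.residueRing (f.pt s) ⟶ S.residueRing s :=
  (Hom.exists_residueMap f s).choose

theorem Hom.residue_residueMap {S X : ResiduedSpace.{u}} (f : S ⟶ X) (s : S.space) :
    (Hom.hom f).hom.stalkMap s ≫ S.residue s = X.residue (f.pt s) ≫ f.residueMap s :=
  (Hom.exists_residueMap f s).choose_spec

theorem Hom.residueMap_unique {S X : ResiduedSpace.{u}} (f : S ⟶ X) (s : S.space)
    (r : X.residueRing (f.pt s) ⟶ S.residueRing s)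
    (hr : (Hom.hom f).hom.stalkMap s ≫ S.residue s = X.residue (f.pt s) ≫ r) :
    r = f.residueMap s := by
  have : Epi (X.residue (f.pt s)) :=
    ConcreteCategory.epi_of_surjective _ (X.residue_surjective _)
  rw [← cancel_epi (X.residue (f.pt s)), ← hr, f.residue_residueMap]

end ResiduedSpace

/-- A scheme with its residue fields. -/
def schemeSpace (S : Scheme.{u}) : ResiduedSpace.{u} where
  space := S.toSheafedSpace
  residueRing s := S.residueField s
  residue s := S.residue s
  residue_surjective s := S.residue_surjective s

/-- The presheaf `U ↦ W_rat(O_X(U))`. -/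
def ratWittPresheaf (X : Scheme.{u}) : TopCat.Presheaf CommRingCat.{u} X.carrier :=
  X.presheaf ⋙ ratWittFunctor

/-- The sheafification `W_rat(O_X)` of the presheaf `U ↦ W_rat(O_X(U))`. -/
def ratWittSheaf (X : Scheme.{u}) : TopCat.Presheaf CommRingCat.{u} X.carrier :=
  sheafify (Opens.grothendieckTopology X.carrier) (ratWittPresheaf X)

theorem ratWittSheaf_isSheaf (X : Scheme.{u}) : (ratWittSheaf X).IsSheaf :=
  ((presheafToSheaf (Opens.grothendieckTopology X.carrier) CommRingCat.{u}).obj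
    (ratWittPresheaf X)).property

/-- The canonical map from the presheaf `U ↦ W_rat(O_X(U))` to its sheafification. -/
def toRatWittSheaf (X : Scheme.{u}) : ratWittPresheaf X ⟶ ratWittSheaf X :=
  toSheafify (Opens.grothendieckTopology X.carrier) (ratWittPresheaf X)

/-- The comparison map from the stalk at `x` of `U ↦ W_rat(O_X(U))` to `W_rat(O_{X,x})`. -/
def ratWittPresheafStalk (X : Scheme.{u}) (x : X) :
    (ratWittPresheaf X).stalk x ⟶ ratWittFunctor.obj (X.presheaf.stalk x) :=
  Limits.colimit.post ((OpenNhds.inclusion x).op ⋙ X.presheaf) ratWittFunctor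

theorem germ_ratWittPresheafStalk (X : Scheme.{u}) (x : X) (U : X.Opens) (hx : x ∈ U) :
    (ratWittPresheaf X).germ U x hx ≫ ratWittPresheafStalk X x =
      ratWittFunctor.map (X.presheaf.germ U x hx) :=
  Limits.colimit.ι_post ((OpenNhds.inclusion x).op ⋙ X.presheaf) ratWittFunctor (op ⟨U, hx⟩)

/-- The canonical map from the stalk of `U ↦ W_rat(O_X(U))` to the stalk of its sheafification. -/
def ratWittStalkMap (X : Scheme.{u}) (x : X) :
    (ratWittPresheaf X).stalk x ⟶ (ratWittSheaf X).stalk x :=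
  (TopCat.Presheaf.stalkFunctor CommRingCat.{u} x).map (toRatWittSheaf X)

instance (X : Scheme.{u}) (x : X) : IsIso (ratWittStalkMap X x) :=
  TopCat.Presheaf.stalkFunctor_map_unit_toSheafify_isIso _ _ _

theorem germ_ratWittStalkMap (X : Scheme.{u}) (x : X) (U : X.Opens) (hx : x ∈ U) :
    (ratWittPresheaf X).germ U x hx ≫ ratWittStalkMap X x =
      (toRatWittSheaf X).app (op U) ≫ (ratWittSheaf X).germ U x hx :=
  TopCat.Presheaf.stalkFunctor_map_germ U x hx (toRatWittSheaf X)

/-- The map `W_rat(O_X)_x → W_rat(κ(x))`, which is the composite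
`W_rat(O_X)_x = W_rat(O_{X,x}) → W_rat(κ(x))`. -/
def ratWittResidue (X : Scheme.{u}) (x : X) :
    (ratWittSheaf X).stalk x ⟶ ratWittFunctor.obj (X.residueField x) :=
  inv (ratWittStalkMap X x) ≫ ratWittPresheafStalk X x ≫ ratWittFunctor.map (X.residue x)

theorem germ_ratWittResidue (X : Scheme.{u}) (x : X) (U : X.Opens) (hx : x ∈ U) :
    (toRatWittSheaf X).app (op U) ≫ (ratWittSheaf X).germ U x hx ≫ ratWittResidue X x =
      ratWittFunctor.map (X.evaluation U x hx) := by
  rw [ratWittResidue, ← Category.assoc, ← germ_ratWittStalkMap, Category.assoc, IsIso.hom_inv_id_assoc,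
    ← Category.assoc, germ_ratWittPresheafStalk]
  exact (ratWittFunctor.map_comp _ _).symm

theorem ratWittSheaf_stalk_hom_ext (X : Scheme.{u}) (x : X) {A : CommRingCat.{u}}
    {f g : (ratWittSheaf X).stalk x ⟶ A}
    (h : ∀ (U : X.Opens) (hx : x ∈ U), (toRatWittSheaf X).app (op U) ≫
      (ratWittSheaf X).germ U x hx ≫ f = (toRatWittSheaf X).app (op U) ≫
      (ratWittSheaf X).germ U x hx ≫ g) : f = g := by
  rw [← cancel_epi (ratWittStalkMap X x)]
  apply TopCat.Presheaf.stalk_hom_ext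
  intro U hx
  rw [← Category.assoc, ← Category.assoc, germ_ratWittStalkMap, Category.assoc, Category.assoc]
  exact h U hx

theorem residue_compat_aux {C : Type*} [Category C] {A B A' B' S T K L : C}
    {a : A ⟶ B} {g : B ⟶ S} {s : S ⟶ T} {r : T ⟶ K} {c : B ⟶ B'} {g' : B' ⟶ T} {w : A ⟶ A'}
    {a' : A' ⟶ B'} {rx : S ⟶ L} {k : L ⟶ K} {e : A ⟶ L} {e' : A' ⟶ K}
    (h1 : g ≫ s = c ≫ g') (h2 : a ≫ c = w ≫ a') (h3 : a ≫ g ≫ rx = e)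
    (h4 : a' ≫ g' ≫ r = e') (h5 : e ≫ k = w ≫ e') : a ≫ g ≫ s ≫ r = a ≫ g ≫ rx ≫ k := by
  rw [← Category.assoc g, h1, Category.assoc, ← Category.assoc a, h2, Category.assoc, h4, ← h5,
    ← h3]
  simp only [Category.assoc]

theorem exists_poly_lift (X : Scheme.{u}) (x : X) (P : (X.residueField x)[X]) :
    ∃ (U : X.Opens) (hx : x ∈ U) (Q : Γ(X, U)[X]), Q.map (X.evaluation U x hx).hom = P := by
  have hres : ∀ (U V : X.Opens) (h : V ≤ U) (hx : x ∈ V) (Q : Γ(X, U)[X]),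
      (Q.map (X.presheaf.map (homOfLE h).op).hom).map (X.evaluation V x hx).hom =
        Q.map (X.evaluation U x (h hx)).hom := by
    intro U V h hx Q
    rw [Polynomial.map_map, ← CommRingCat.hom_comp]
    congr 2
    simp [Scheme.evaluation]
  induction P using Polynomial.induction_on' with
  | add p q hp hq =>
    obtain ⟨U, hU, p', hp'⟩ := hp
    obtain ⟨V, hV, q', hq'⟩ := hq
    have hUV : x ∈ U ⊓ V := ⟨hU, hV⟩
    refine ⟨U ⊓ V, hUV, p'.map (X.presheaf.map (homOfLE inf_le_left).op).hom +
      q'.map (X.presheaf.map (homOfLE inf_le_right).op).hom, ?_⟩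
    rw [Polynomial.map_add, hres U (U ⊓ V) inf_le_left hUV, hres V (U ⊓ V) inf_le_right hUV, hp', hq']
  | monomial n a =>
    obtain ⟨b, hb⟩ := X.residue_surjective x a
    obtain ⟨U, hU, c, hc⟩ := X.presheaf.exists_germ_eq b
    refine ⟨U, hU, Polynomial.monomial n c, ?_⟩
    rw [Polynomial.map_monomial, ← hb, ← hc]
    rfl

theorem ratWittResidue_surjective (X : Scheme.{u}) (x : X) :
    Function.Surjective (ratWittResidue X x).hom := by
  have key : ∀ (P : (X.residueField x)[X]) (hP : P.coeff 0 = 1),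
      ∃ w, (ratWittResidue X x).hom w = RatWitt.ofPoly P hP := by
    intro P hP
    obtain ⟨U, hx, Q, hQ⟩ := exists_poly_lift X x P
    let Q' : Γ(X, U)[X] := Q - Polynomial.C (Q.coeff 0) + 1
    have hQ' : Q'.coeff 0 = 1 := by simp [Q']
    refine ⟨((toRatWittSheaf X).app (op U) ≫ (ratWittSheaf X).germ U x hx).hom
      (RatWitt.ofPoly Q' hQ'), ?_⟩
    have h := congrArg (fun f => f.hom (RatWitt.ofPoly Q' hQ')) (germ_ratWittResidue X x U hx)
    refine h.trans (RatWitt.ext ?_)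
    change PowerSeries.map (X.evaluation U x hx).hom (Q' : Γ(X, U)⟦X⟧) = P
    rw [← Polynomial.polynomial_map_coe]
    congr 1
    have h0 : (X.evaluation U x hx).hom (Q.coeff 0) = 1 := by
      rw [← Polynomial.coeff_map, hQ, hP]
    simp [Q', hQ, h0]
  intro w
  obtain ⟨P, Q, hP, hQ, rfl⟩ := RatWitt.exists_ofPoly (w : RatWitt (X.residueField x))
  obtain ⟨v, hv⟩ := key P hP
  obtain ⟨v', hv'⟩ := key Q hQ
  exact ⟨v - v', by rw [map_sub, hv, hv']; rfl⟩

/-- The rational Witt space `W_rat(X) = (X_top, W_rat(O_X))` of a scheme `X`, with the quotients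
`W_rat(O_X)_x → W_rat(κ(x))` of its stalks. -/
def ratWittSpace (X : Scheme.{u}) : ResiduedSpace.{u} where
  space := { carrier := X.carrier, presheaf := (ratWittSheaf X), IsSheaf := ratWittSheaf_isSheaf X }
  residueRing x := ratWittFunctor.obj (X.residueField x)
  residue x := ratWittResidue X x
  residue_surjective x := ratWittResidue_surjective X x

/-- The comorphism of `W_rat(α)`. -/
def ratWittMapC {X Y : Scheme.{u}} (α : Y ⟶ X) :
    (ratWittSheaf X) ⟶ (TopCat.Presheaf.pushforward CommRingCat.{u} α.base).obj (ratWittSheaf Y) :=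
  sheafifyLift (Opens.grothendieckTopology X.carrier)
    (Functor.whiskerRight α.c ratWittFunctor ≫
      (TopCat.Presheaf.pushforward CommRingCat.{u} α.base).map (toRatWittSheaf Y))
    (TopCat.Sheaf.pushforward_sheaf_of_sheaf α.base (ratWittSheaf_isSheaf Y))

theorem toRatWittSheaf_ratWittMapC {X Y : Scheme.{u}} (α : Y ⟶ X) :
    toRatWittSheaf X ≫ ratWittMapC α = Functor.whiskerRight α.c ratWittFunctor ≫
      (TopCat.Presheaf.pushforward CommRingCat.{u} α.base).map (toRatWittSheaf Y) :=
  toSheafify_sheafifyLift _ _ _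

/-- The morphism `W_rat(α) : W_rat(Y) → W_rat(X)` induced by a morphism of schemes `α : Y → X`. -/
def ratWittMap {X Y : Scheme.{u}} (α : Y ⟶ X) : ratWittSpace Y ⟶ ratWittSpace X :=
  ResiduedSpace.Hom.mk (InducedCategory.homMk ⟨α.base, ratWittMapC α⟩) fun y => by
    refine ⟨ratWittFunctor.map (α.residueFieldMap y), ?_⟩
    apply ratWittSheaf_stalk_hom_ext
    intro U hx
    have h1 := PresheafedSpace.stalkMap_germ (X := (ratWittSpace Y).space.toPresheafedSpace)
      (Y := (ratWittSpace X).space.toPresheafedSpace) ⟨α.base, ratWittMapC α⟩ U y hx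
    have h2 := NatTrans.congr_app (toRatWittSheaf_ratWittMapC α) (op U)
    have h3 := germ_ratWittResidue X (α y) U hx
    have h4 := germ_ratWittResidue Y y (α ⁻¹ᵁ U) hx
    have h5 := congrArg (fun f => ratWittFunctor.map f) (Scheme.evaluation_naturality α y hx)
    simp only [Functor.map_comp] at h5
    exact residue_compat_aux h1 h2 h3 h4 h5

/-- The endomorphism `F_ν` of the presheaf `U ↦ W_rat(O_X(U))`. -/
def ratWittPresheafFrob (X : Scheme.{u}) (ν : ℕ+) : ratWittPresheaf X ⟶ ratWittPresheaf X :=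
  Functor.whiskerLeft X.presheaf (ratWittFrobenius ν)

/-- The endomorphism `F_ν` of the sheaf `W_rat(O_X)`. -/
def ratWittSheafFrob (X : Scheme.{u}) (ν : ℕ+) : ratWittSheaf X ⟶ ratWittSheaf X :=
  sheafifyMap (Opens.grothendieckTopology X.carrier) (ratWittPresheafFrob X ν)

theorem toRatWittSheaf_frob (X : Scheme.{u}) (ν : ℕ+) :
    toRatWittSheaf X ≫ ratWittSheafFrob X ν = ratWittPresheafFrob X ν ≫ toRatWittSheaf X :=
  (toSheafify_naturality (Opens.grothendieckTopology X.carrier) (ratWittPresheafFrob X ν)).symm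

theorem ratWittSheaf_hom_ext (X : Scheme.{u}) {f g : ratWittSheaf X ⟶ ratWittSheaf X}
    (h : toRatWittSheaf X ≫ f = toRatWittSheaf X ≫ g) : f = g :=
  sheafify_hom_ext _ _ _ (ratWittSheaf_isSheaf X) h

theorem ratWittSheafFrob_one (X : Scheme.{u}) : ratWittSheafFrob X 1 = 𝟙 _ := by
  apply ratWittSheaf_hom_ext
  have e : ratWittPresheafFrob X 1 = 𝟙 _ := by
    refine NatTrans.ext (funext fun U => CommRingCat.hom_ext ?_)
    exact RatWitt.frobenius_one (R := X.presheaf.obj U)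
  rw [toRatWittSheaf_frob, e, Category.id_comp, Category.comp_id]

theorem ratWittSheafFrob_mul (X : Scheme.{u}) (μ ν : ℕ+) :
    ratWittSheafFrob X (μ * ν) = ratWittSheafFrob X μ ≫ ratWittSheafFrob X ν := by
  apply ratWittSheaf_hom_ext
  have e : ratWittPresheafFrob X (μ * ν) = ratWittPresheafFrob X μ ≫ ratWittPresheafFrob X ν := by
    rw [mul_comm]
    refine NatTrans.ext (funext fun U => CommRingCat.hom_ext ?_)
    exact RatWitt.frobenius_mul (R := X.presheaf.obj U) ν μ
  rw [toRatWittSheaf_frob, ← Category.assoc, toRatWittSheaf_frob, Category.assoc,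
    toRatWittSheaf_frob, e, Category.assoc]

/-- The Frobenius endomorphism `F_ν` of `W_rat(X)`. -/
def ratWittFrob (X : Scheme.{u}) (ν : ℕ+) : ratWittSpace X ⟶ ratWittSpace X :=
  ResiduedSpace.Hom.mk (InducedCategory.homMk ⟨𝟙 _,
    ratWittSheafFrob X ν⟩) fun y => by
    refine ⟨(ratWittFrobenius ν).app (X.residueField y), ?_⟩
    apply ratWittSheaf_stalk_hom_ext
    intro U hx
    have h1 := PresheafedSpace.stalkMap_germ (X := (ratWittSpace X).space.toPresheafedSpace)
      (Y := (ratWittSpace X).space.toPresheafedSpace) ⟨𝟙 _, ratWittSheafFrob X ν⟩ U y hx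
    have h2 := NatTrans.congr_app (toRatWittSheaf_frob X ν) (op U)
    have h3 := germ_ratWittResidue X y U hx
    have h5 := (ratWittFrobenius ν).naturality (X.evaluation U y hx)
    exact residue_compat_aux h1 h2 h3 h3 h5

theorem ratWittFrob_one (X : Scheme.{u}) : ratWittFrob X 1 = 𝟙 _ := by
  apply ResiduedSpace.Hom.ext
  apply InducedCategory.hom_ext
  refine congrArg (PresheafedSpace.Hom.mk (𝟙 _)) ?_
  exact ratWittSheafFrob_one X

theorem ratWittFrob_mul (X : Scheme.{u}) (μ ν : ℕ+) :
    ratWittFrob X (μ * ν) = ratWittFrob X ν ≫ ratWittFrob X μ := by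
  apply ResiduedSpace.Hom.ext
  apply InducedCategory.hom_ext
  refine congrArg (PresheafedSpace.Hom.mk (𝟙 _)) ?_
  exact ratWittSheafFrob_mul X μ ν

/-- The `S`-valued points of `W_rat(X)`. -/
def RatWittPoints (X S : Scheme.{u}) : Type u := schemeSpace S ⟶ ratWittSpace X

namespace RatWittPoints

/-- The map `W_rat(Y)(S) → W_rat(X)(S)` induced by a morphism `Y → X`. -/
def map {X Y S : Scheme.{u}} (α : Y ⟶ X) (P : RatWittPoints Y S) : RatWittPoints X S :=
  P ≫ ratWittMap α

/-- The action of the multiplicative monoid of positive integers on `W_rat(X)(S)` through the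
Frobenius endomorphisms `F_ν` of `W_rat(X)`. -/
instance {X S : Scheme.{u}} : MulAction ℕ+ (RatWittPoints X S) where
  smul ν P := P ≫ ratWittFrob X ν
  one_smul P := by
    change P ≫ ratWittFrob X 1 = P
    rw [ratWittFrob_one]
    exact Category.comp_id _
  mul_smul μ ν P := by
    change P ≫ ratWittFrob X (μ * ν) = (P ≫ ratWittFrob X ν) ≫ ratWittFrob X μ
    rw [ratWittFrob_mul]
    exact (Category.assoc _ _ _).symm

end RatWittPoints

/-- `spec ℂ`; the `ULift` only moves the field `ℂ` to the universe at hand. -/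
def specComplex : Scheme.{u} := Spec (CommRingCat.of (ULift.{u} ℂ))

/-- The point of `spec ℂ`. -/
def specComplexPt : specComplex.{u} := IsLocalRing.closedPoint (ULift.{u} ℂ)

/-- The identification of the stalk of `spec ℂ` with `ℂ`. -/
def specComplexStalk :
    specComplex.{u}.presheaf.stalk specComplexPt ⟶ CommRingCat.of (ULift.{u} ℂ) :=
  (stalkClosedPointIso (CommRingCat.of (ULift.{u} ℂ))).hom

instance : IsIso specComplexStalk.{u} :=
  inferInstanceAs (IsIso (stalkClosedPointIso (CommRingCat.of (ULift.{u} ℂ))).hom)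

instance : IsLocalHom specComplexStalk.{u}.hom := isLocalHom_of_isIso _

/-- The identification of the residue field of `spec ℂ` with `ℂ`. -/
def specComplexResidue : specComplex.{u}.residueField specComplexPt →+* ℂ :=
  (ULift.ringEquiv : ULift.{u} ℂ ≃+* ℂ).toRingHom.comp
    (specComplex.{u}.descResidueField specComplexStalk.{u}).hom

/-- The set of pairs `(x, χ)` of a point `x` of a scheme `X` and a homomorphism
`χ : κ(x)ˣ → ℂˣ`. -/
structure CharPair (X : Scheme.{u}) : Type u where
  /-- The point. -/
  pt : X
  /-- The character. -/
  char : (X.residueField pt)ˣ →* ℂˣ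

namespace CharPair

/-- A morphism `f : X → Y` sends `(x, χ)` to `(f(x), χ ∘ f^♯)` with `f^♯ : κ(f(x))ˣ → κ(x)ˣ`. -/
def push {X Y : Scheme.{u}} (f : X ⟶ Y) (p : CharPair X) : CharPair Y :=
  ⟨f p.pt, p.char.comp (Units.map (f.residueFieldMap p.pt).hom.toMonoidHom)⟩

theorem push_id {X : Scheme.{u}} (p : CharPair X) : push (𝟙 X) p = p := by
  obtain ⟨x, χ⟩ := p
  simp only [push, Scheme.residueFieldMap_id]
  rfl

theorem push_comp {X Y Z : Scheme.{u}} (f : X ⟶ Y) (g : Y ⟶ Z) (p : CharPair X) :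
    push (f ≫ g) p = push g (push f p) := by
  obtain ⟨x, χ⟩ := p
  simp only [push, Scheme.residueFieldMap_comp]
  rfl

/-- The action of positive integers: `F_ν (x, χ) = (x, χ ∘ ( )^ν)`. -/
instance {X : Scheme.{u}} : MulAction ℕ+ (CharPair X) where
  smul ν p := ⟨p.pt, p.char.comp (powMonoidHom (ν : ℕ))⟩
  one_smul p := by
    obtain ⟨x, χ⟩ := p
    change CharPair.mk x _ = _
    congr 1
    ext a
    simp
  mul_smul μ ν p := by
    obtain ⟨x, χ⟩ := p
    refine congrArg (CharPair.mk x) (MonoidHom.ext fun a => ?_)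
    change χ (a ^ ((μ * ν : ℕ+) : ℕ)) = χ ((a ^ (μ : ℕ)) ^ (ν : ℕ))
    rw [PNat.mul_coe, pow_mul]

theorem push_smul {X Y : Scheme.{u}} (f : X ⟶ Y) (ν : ℕ+) (p : CharPair X) :
    push f (ν • p) = ν • push f p := by
  obtain ⟨x, χ⟩ := p
  refine congrArg (CharPair.mk (f x)) (MonoidHom.ext fun a => ?_)
  exact congrArg χ (map_pow (Units.map (f.residueFieldMap x).hom.toMonoidHom) a (ν : ℕ)).symm

/-- A point `P ∈ W_rat(X)(ℂ)` has an underlying point `x ∈ X` and induces a ring homomorphism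
`W_rat(κ(x)) → ℂ`; composition with the Teichmüller map gives a character `κ(x)ˣ → ℂˣ`. -/
def ofPoint {X : Scheme.{u}} (P : RatWittPoints X specComplex.{u}) : CharPair X :=
  let x : X := ResiduedSpace.Hom.pt P specComplexPt
  let r : RatWitt (X.residueField x) →+* specComplex.{u}.residueField specComplexPt :=
    (ResiduedSpace.Hom.residueMap P specComplexPt).hom
  ⟨x, Units.map (((specComplexResidue.comp r : RatWitt (X.residueField x) →+* ℂ) :
    RatWitt (X.residueField x) →* ℂ).comp RatWitt.teichmuller)⟩

end CharPair

/-! ### The normalization in an algebraic closure and its Galois action -/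

section Normalization

variable (X : Scheme.{u}) [IsIntegral X] (K : Type u) [Field K] [Algebra X.functionField K]

/-- The morphism `spec K → X` for an extension field `K` of the function field of `X`. -/
def specToScheme : Spec (CommRingCat.of K) ⟶ X :=
  Spec.map (CommRingCat.ofHom (algebraMap X.functionField K)) ≫ X.fromSpecStalk (genericPoint X)

instance : QuasiCompact (specToScheme X K) where
  isCompact_preimage _ _ _ := (Set.toFinite _).isCompact

instance : QuasiSeparated (specToScheme X K) := by
  have : QuasiSeparated (specToScheme X K ≫ Limits.terminal.from X) := by
    infer_instance
  exact QuasiSeparated.of_comp _ (Limits.terminal.from X)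

/-- The normalization of `X` in `K`. -/
abbrev normalizationIn : Scheme.{u} := (specToScheme X K).normalization

variable {K}

theorem specMap_specToScheme (σ : Gal(K/X.functionField)) :
    Spec.map (CommRingCat.ofHom (σ : K →+* K)) ≫ specToScheme X K = specToScheme X K := by
  rw [specToScheme, ← Category.assoc, ← Spec.map_comp, ← CommRingCat.ofHom_comp]
  congr 3
  ext a
  simp

/-- The automorphism of the normalization of `X` in `K` over `X` induced by `σ ∈ Aut(K / K₀)`,
namely `spec` of the restriction of `σ` to the rings of integral elements in `K`. Contravariance
gives a right action: `galHom (σ τ)` is first `galHom σ`, then `galHom τ`. -/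
def galHom (σ : Gal(K/X.functionField)) : normalizationIn X K ⟶ normalizationIn X K :=
  (specToScheme X K).normalizationDesc
    (Spec.map (CommRingCat.ofHom (σ : K →+* K)) ≫ (specToScheme X K).toNormalization)
    (specToScheme X K).fromNormalization (by
      rw [Category.assoc, Scheme.Hom.toNormalization_fromNormalization, specMap_specToScheme])

theorem toNormalization_galHom (σ : Gal(K/X.functionField)) :
    (specToScheme X K).toNormalization ≫ galHom X σ =
      Spec.map (CommRingCat.ofHom (σ : K →+* K)) ≫ (specToScheme X K).toNormalization :=
  Scheme.Hom.toNormalization_normalizationDesc _ _ _ _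

theorem galHom_fromNormalization (σ : Gal(K/X.functionField)) :
    galHom X σ ≫ (specToScheme X K).fromNormalization = (specToScheme X K).fromNormalization :=
  Scheme.Hom.normalizationDesc_comp _ _ _ _

theorem galHom_one : galHom X (1 : Gal(K/X.functionField)) = 𝟙 _ := by
  apply Scheme.Hom.normalization.hom_ext _ _ _ (specToScheme X K).fromNormalization
  · rw [toNormalization_galHom, Category.comp_id]
    have : CommRingCat.ofHom ((1 : Gal(K/X.functionField)) : K →+* K) = 𝟙 (CommRingCat.of K) := rfl
    rw [this, Spec.map_id, Category.id_comp]
  · exact galHom_fromNormalization X 1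
  · exact Category.id_comp _

theorem galHom_mul (σ τ : Gal(K/X.functionField)) :
    galHom X (σ * τ) = galHom X σ ≫ galHom X τ := by
  apply Scheme.Hom.normalization.hom_ext _ _ _ (specToScheme X K).fromNormalization
  · have : CommRingCat.ofHom ((σ * τ : Gal(K/X.functionField)) : K →+* K) =
      CommRingCat.ofHom (τ : K →+* K) ≫ CommRingCat.ofHom (σ : K →+* K) := rfl
    rw [toNormalization_galHom, ← Category.assoc, toNormalization_galHom, Category.assoc,
      toNormalization_galHom, this, Spec.map_comp, Category.assoc]
  · exact galHom_fromNormalization X _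
  · rw [Category.assoc, galHom_fromNormalization, galHom_fromNormalization]

/-- The right action of `Aut(K / K₀)` on pairs: `(x, χ)^σ = (x^σ, χ ∘ σ)`. -/
instance : MulAction (Gal(K/X.functionField))ᵐᵒᵖ (CharPair (normalizationIn X K)) where
  smul σ p := p.push (galHom X σ.unop)
  one_smul p := by
    change CharPair.push (galHom X 1) p = p
    rw [galHom_one, CharPair.push_id]
  mul_smul σ τ p := by
    change CharPair.push (galHom X (τ.unop * σ.unop)) p = _
    rw [galHom_mul, CharPair.push_comp]
    rfl

instance : SMulCommClass ℕ+ (Gal(K/X.functionField))ᵐᵒᵖ (CharPair (normalizationIn X K)) where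
  smul_comm ν σ p := (CharPair.push_smul (galHom X σ.unop) ν p).symm

variable (K)

/-- The set of orbits of `Aut(K / K₀)` on the pairs `(x, χ)` -/
def CharOrbit : Type u :=
  MulAction.orbitRel.Quotient (Gal(K/X.functionField))ᵐᵒᵖ (CharPair (normalizationIn X K))

/-- The orbit of a pair. -/
def CharOrbit.mk (p : CharPair (normalizationIn X K)) : CharOrbit X K :=
  Quotient.mk _ p

/-- The induced action of the positive integers on orbits. -/
instance : MulAction ℕ+ (CharOrbit X K) where
  smul ν := Quotient.map (ν • ·) (by
    rintro _ p ⟨σ, rfl⟩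
    exact ⟨σ, (smul_comm ν σ p).symm⟩)
  one_smul := by
    rintro ⟨p⟩
    exact congrArg (CharOrbit.mk X K) (one_smul ℕ+ p)
  mul_smul μ ν := by
    rintro ⟨p⟩
    exact congrArg (CharOrbit.mk X K) (mul_smul μ ν p)

end Normalization

end

/-! Since `spec ℂ` has one point, with ring of sections ℂ on the whole space and 0 on the empty set,
a complex point of W_rat(X) is the same as a pair (x, φ) with x ∈ X and φ : W_rat(κ(x)) → ℂ an
arbitrary ring homomorphism (`RatWittHomPair.ofPoint_bijective`). The proof works with these pairs
throughout.

If L is an algebraically closed field, every det(1 - tA) factors into terms 1 - λt. So W_rat(L) is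
the group ring ℤ[Lˣ] on the Teichmüller elements, and its homomorphisms to ℂ are the characters of
Lˣ. On the normalization in K all residue fields are algebraically closed
(`normalizationIn_isAlgClosed_residueField`), because its affine coordinate rings are integral
closures in K and contain the roots of their monic polynomials. Hence ε is bijective.

Every point of W_rat(X₀)(ℂ) lifts to the normalization: π is integral and surjective, for an
algebraic extension L/k with L algebraically closed the ring W_rat(L) is integral over W_rat(k)
(`RatWitt.map_isIntegral`), and homomorphisms into ℂ extend along injective integral maps.

It remains to see that two lifts of the same point are conjugate
(`RatWitt.exists_gal_of_comp_map_eq`). On an affine chart, let A be the normal coordinate ring, B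
its integral closure in K, and let F, F' : W_rat(B) → ℂ agree on W_rat(A). If ∏(X - bᵢ) has
coefficients in the perfect closure E of K₀ in K, then some power of ∏(1 - bᵢt) has coefficients in
A. So F and F' agree on a positive multiple of Σ[bᵢ], hence on Σ[bᵢ], as ℂ has characteristic zero.
Applied to the conjugates of b in a finite Galois extension of E, this says that the characters
F∘[·]∘s and F'∘[·]∘s, summed over the Galois group, agree. Linear independence of characters makes
F' a conjugate of F there, and compactness of Gal(K/E) gives a single σ (`exists_gal_of_sum_eq`).
The characters may vanish on nonzero elements, so the conjugacy of primes over a prime of A is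
obtained at the same time. Conversely conjugate pairs have equal image because σ acts over X₀. -/

noncomputable section

namespace RatWitt

/-! ### Polynomials as rational Witt vectors -/

section Poly

variable {R S : Type u} [CommRing R] [CommRing S]

theorem ofPoly_congr {P Q : R[X]} (h : P = Q) (hP : P.coeff 0 = 1) :
    ofPoly P hP = ofPoly Q (h ▸ hP) := by
  subst h; rfl

theorem ofPoly_mul {P Q : R[X]} (hP : P.coeff 0 = 1) (hQ : Q.coeff 0 = 1)
    (h : (P * Q).coeff 0 = 1) : ofPoly (P * Q) h = ofPoly P hP + ofPoly Q hQ :=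
  ext (by simp)

theorem ofPoly_one : ofPoly (1 : R[X]) (by simp) = 0 := ext (by simp)

theorem coeff_zero_pow {P : R[X]} (hP : P.coeff 0 = 1) (n : ℕ) : (P ^ n).coeff 0 = 1 := by
  rw [Polynomial.coeff_zero_eq_eval_zero] at hP ⊢
  rw [Polynomial.eval_pow, hP, one_pow]

theorem ofPoly_pow {P : R[X]} (hP : P.coeff 0 = 1) (n : ℕ) :
    ofPoly (P ^ n) (coeff_zero_pow hP n) = n • ofPoly P hP := by
  induction n with
  | zero => exact (ofPoly_congr (pow_zero P) _).trans (ofPoly_one.trans (zero_nsmul _).symm)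
  | succ n ih =>
    rw [ofPoly_congr (pow_succ P n) _, ofPoly_mul (coeff_zero_pow hP n) hP, ih, succ_nsmul]

theorem coeff_zero_map (f : R →+* S) {P : R[X]} (hP : P.coeff 0 = 1) :
    (P.map f).coeff 0 = 1 := by
  rw [Polynomial.coeff_map, hP, map_one]

theorem map_ofPoly (f : R →+* S) {P : R[X]} (hP : P.coeff 0 = 1) :
    map f (ofPoly P hP) = ofPoly (P.map f) (coeff_zero_map f hP) :=
  ext (by simp [Polynomial.polynomial_map_coe])

theorem coeff_zero_one_sub (r : R) : (1 - Polynomial.C r * Polynomial.X : R[X]).coeff 0 = 1 := by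
  simp

theorem teichmuller_eq_ofPoly (r : R) :
    teichmuller r = ofPoly (1 - Polynomial.C r * Polynomial.X) (coeff_zero_one_sub r) :=
  ext (by simp [series_teichmuller])

theorem teichmuller_zero : teichmuller (0 : R) = 0 :=
  ext (by simp [series_teichmuller])

theorem coeff_zero_prod (s : Multiset R) :
    (s.map fun a => (1 - Polynomial.C a * Polynomial.X : R[X])).prod.coeff 0 = 1 := by
  rw [Polynomial.coeff_zero_eq_eval_zero, Polynomial.eval_multiset_prod]
  simp

/-- Addition in W_rat is multiplication of polynomials, so a product of linear factors is a sum of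
Teichmüller elements. -/
theorem ofPoly_multiset_prod (s : Multiset R) :
    ofPoly (s.map fun a => (1 - Polynomial.C a * Polynomial.X : R[X])).prod (coeff_zero_prod s) =
      (s.map teichmuller).sum := by
  induction s using Multiset.induction with
  | empty => exact ofPoly_one
  | cons a s ih =>
    have e : ((a ::ₘ s).map fun a => (1 - Polynomial.C a * Polynomial.X : R[X])).prod =
        (1 - Polynomial.C a * Polynomial.X) *
          (s.map fun a => (1 - Polynomial.C a * Polynomial.X : R[X])).prod := by
      rw [Multiset.map_cons, Multiset.prod_cons]
    rw [Multiset.map_cons teichmuller, Multiset.sum_cons, ← ih, teichmuller_eq_ofPoly,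
      ofPoly_congr e, ofPoly_mul (coeff_zero_one_sub a) (coeff_zero_prod s)]

theorem map_injective {f : R →+* S} (hf : Function.Injective f) : Function.Injective (map f) := by
  intro v w h
  refine ext (PowerSeries.map_injective f hf ?_)
  rw [← series_map, ← series_map, h]

theorem ofPoly_add_eq_of_ofPoly_sub_eq {P Q P' Q' : R[X]} (hP : P.coeff 0 = 1) (hQ : Q.coeff 0 = 1)
    (hP' : P'.coeff 0 = 1) (hQ' : Q'.coeff 0 = 1)
    (h : ofPoly P hP - ofPoly Q hQ = ofPoly P' hP' - ofPoly Q' hQ') : P * Q' = P' * Q := by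
  rw [sub_eq_sub_iff_add_eq_add] at h
  apply Polynomial.coe_injective R
  simpa using congrArg series h

theorem ne_zero_of_coeff_zero [Nontrivial R] {P : R[X]} (hP : P.coeff 0 = 1) : P ≠ 0 := by
  rintro rfl
  simp at hP

end Poly

/-! ### W_rat of an algebraically closed field: generation by Teichmüller elements -/

section AlgClosed

variable {L : Type u} [Field L]

theorem reverse_prod_X_sub_C (s : Multiset L) :
    (s.map fun a => Polynomial.X - Polynomial.C a).prod.reverse =
      (s.map fun a => (1 - Polynomial.C a * Polynomial.X : L[X])).prod := by
  induction s using Multiset.induction with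
  | empty =>
    change (1 : L[X]).reverse = 1
    rw [← Polynomial.C_1, Polynomial.reverse_C]
  | cons a s ih =>
    rw [Multiset.map_cons, Multiset.map_cons, Multiset.prod_cons, Multiset.prod_cons,
      Polynomial.reverse_mul_of_domain, ih]
    congr 1
    rw [Polynomial.reverse, Polynomial.natDegree_X_sub_C, Polynomial.reflect_sub,
      Polynomial.reflect_C, Polynomial.reflect_one_X, pow_one]

variable [IsAlgClosed L]

/-- The characteristic polynomial splits, and reversing it turns each factor X - λ into 1 - λt,
which is [λ]. -/
theorem cls_eq_sum_teichmuller {n : Type*} [Fintype n] [DecidableEq n] (A : Matrix n n L) :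
    cls A = (A.charpoly.roots.map teichmuller).sum := by
  rw [← ofPoly_multiset_prod, cls]
  have h := (IsAlgClosed.splits A.charpoly).eq_prod_roots_of_monic A.charpoly_monic
  have h' : A.charpolyRev =
      (A.charpoly.roots.map fun a => (1 - Polynomial.C a * Polynomial.X : L[X])).prod := by
    rw [← Matrix.reverse_charpoly, ← reverse_prod_X_sub_C, ← h]
  exact ofPoly_congr h' _

theorem closure_range_teichmuller :
    AddSubgroup.closure (Set.range (teichmuller : L → RatWitt L)) = ⊤ := by
  rw [eq_top_iff]
  rintro w -
  obtain ⟨k, l, A, B, rfl⟩ := exists_cls w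
  have key : ∀ (k : ℕ) (A : Matrix (Fin k) (Fin k) L),
      cls A ∈ AddSubgroup.closure (Set.range (teichmuller : L → RatWitt L)) := by
    intro k A
    rw [cls_eq_sum_teichmuller]
    refine multiset_sum_mem _ fun x hx => ?_
    obtain ⟨a, -, rfl⟩ := Multiset.mem_map.mp hx
    exact AddSubgroup.subset_closure ⟨a, rfl⟩
  exact sub_mem (key k A) (key l B)

theorem addMonoidHom_ext_teichmuller {A : Type*} [AddGroup A] {φ ψ : RatWitt L →+ A}
    (h : ∀ a, φ (teichmuller a) = ψ (teichmuller a)) : φ = ψ :=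
  AddMonoidHom.eq_of_eqOn_dense closure_range_teichmuller (by rintro _ ⟨a, rfl⟩; exact h a)

theorem ringHom_ext_teichmuller {A : Type*} [Ring A] {φ ψ : RatWitt L →+* A}
    (h : ∀ a, φ (teichmuller a) = ψ (teichmuller a)) : φ = ψ :=
  RingHom.coe_addMonoidHom_injective (addMonoidHom_ext_teichmuller h)

end AlgClosed

/-! ### Extending a multiplicative map on L to W_rat(L) -/

section OfCharacter

variable {L : Type u} [Field L] {A : Type*} [CommRing A] (h : L →*₀ A)

/-- The sum of `h` over the inverses of the roots of `P`. -/
def sumInvRoots (P : L[X]) : A := (P.roots.map fun r => h r⁻¹).sum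

theorem sumInvRoots_mul {P Q : L[X]} (hP : P ≠ 0) (hQ : Q ≠ 0) :
    sumInvRoots h (P * Q) = sumInvRoots h P + sumInvRoots h Q := by
  simp [sumInvRoots, Polynomial.roots_mul (mul_ne_zero hP hQ)]

/-- The root of 1 - at is a⁻¹, whence the inverse in `sumInvRoots`. For a = 0 there is no root and
the empty sum equals h 0 = 0. -/
theorem sumInvRoots_one_sub (a : L) :
    sumInvRoots h (1 - Polynomial.C a * Polynomial.X) = h a := by
  by_cases ha : a = 0
  · simp [ha, sumInvRoots]
  · have e : (1 - Polynomial.C a * Polynomial.X : L[X]) =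
        Polynomial.C (-a) * (Polynomial.X - Polynomial.C a⁻¹) := by
      rw [mul_sub, ← Polynomial.C_mul, neg_mul, mul_inv_cancel₀ ha]
      simp; ring
    rw [sumInvRoots, e, Polynomial.roots_C_mul _ (neg_ne_zero.mpr ha), Polynomial.roots_X_sub_C]
    simp

/-- The additive map on `W_rat(L)` extending `h`. -/
def ofCharacterFun (w : RatWitt L) : A :=
  sumInvRoots h (exists_ofPoly w).choose - sumInvRoots h (exists_ofPoly w).choose_spec.choose

/-- Independence of the chosen fraction: P/Q = P'/Q' means PQ' = P'Q, and `sumInvRoots` turns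
products into sums. -/
theorem ofCharacterFun_ofPoly_sub {P Q : L[X]} (hP : P.coeff 0 = 1) (hQ : Q.coeff 0 = 1) :
    ofCharacterFun h (ofPoly P hP - ofPoly Q hQ) = sumInvRoots h P - sumInvRoots h Q := by
  set w := ofPoly P hP - ofPoly Q hQ with hw
  obtain ⟨hP', hQ', h'⟩ := (exists_ofPoly w).choose_spec.choose_spec
  have e := ofPoly_add_eq_of_ofPoly_sub_eq hP hQ hP' hQ' (hw.symm.trans h')
  have e' := congrArg (sumInvRoots h) e
  rw [sumInvRoots_mul h (ne_zero_of_coeff_zero hP) (ne_zero_of_coeff_zero hQ'),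
    sumInvRoots_mul h (ne_zero_of_coeff_zero hP') (ne_zero_of_coeff_zero hQ)] at e'
  rw [ofCharacterFun, sub_eq_sub_iff_add_eq_add, ← e']

/-- The additive homomorphism on `W_rat(L)` with `[a] ↦ h a`. -/
def ofCharacterAdd : RatWitt L →+ A :=
  AddMonoidHom.mk' (ofCharacterFun h) fun v w => by
    obtain ⟨P, Q, hP, hQ, rfl⟩ := exists_ofPoly v
    obtain ⟨P', Q', hP', hQ', rfl⟩ := exists_ofPoly w
    have c : ∀ {P Q : L[X]}, P.coeff 0 = 1 → Q.coeff 0 = 1 → (P * Q).coeff 0 = 1 := by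
      intro P Q hP hQ
      rw [Polynomial.mul_coeff_zero, hP, hQ, one_mul]
    rw [sub_add_sub_comm, ← ofPoly_mul hP hP' (c hP hP'), ← ofPoly_mul hQ hQ' (c hQ hQ'),
      ofCharacterFun_ofPoly_sub, ofCharacterFun_ofPoly_sub, ofCharacterFun_ofPoly_sub,
      sumInvRoots_mul h (ne_zero_of_coeff_zero hP) (ne_zero_of_coeff_zero hP'),
      sumInvRoots_mul h (ne_zero_of_coeff_zero hQ) (ne_zero_of_coeff_zero hQ')]
    abel

theorem ofCharacterAdd_teichmuller (a : L) : ofCharacterAdd h (teichmuller a) = h a := by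
  have e := ofCharacterFun_ofPoly_sub h (coeff_zero_one_sub a) (Q := 1) (by simp)
  rw [ofPoly_one, sub_zero, ← teichmuller_eq_ofPoly, sumInvRoots_one_sub] at e
  refine e.trans ?_
  simp [sumInvRoots]

variable [IsAlgClosed L]

/-- The ring homomorphism on `W_rat(L)`, for `L` algebraically closed, with `[a] ↦ h a`. -/
def ofCharacter : RatWitt L →+* A :=
  { ofCharacterAdd h with
    map_one' := by
      have := ofCharacterAdd_teichmuller h 1
      rwa [map_one teichmuller, map_one h] at this
    map_mul' := by
      -- Multiplicativity is an identity between biadditive maps, so it may be tested on pairs [a],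
      -- [b], where it is the multiplicativity of h.
      have e : ((AddMonoidHom.mul : A →+ A →+ A).compl₂ (ofCharacterAdd h)).comp (ofCharacterAdd h) =
          (AddMonoidHom.mul : RatWitt L →+ RatWitt L →+ RatWitt L).compr₂ (ofCharacterAdd h) := by
        refine addMonoidHom_ext_teichmuller fun a => addMonoidHom_ext_teichmuller fun b => ?_
        change ofCharacterAdd h _ * ofCharacterAdd h _ = ofCharacterAdd h (_ * _)
        rw [← map_mul teichmuller, ofCharacterAdd_teichmuller, ofCharacterAdd_teichmuller,
          ofCharacterAdd_teichmuller, map_mul]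
      intro v w
      exact (DFunLike.congr_fun (DFunLike.congr_fun e v) w).symm }

theorem ofCharacter_teichmuller (a : L) : ofCharacter h (teichmuller a) = h a :=
  ofCharacterAdd_teichmuller h a

end OfCharacter

end RatWitt

/-! ### Symmetric functions and integrality of W_rat(k) → W_rat(L) -/

/-- A symmetric integral polynomial in the roots of a polynomial over `R` has its value in `R`. -/
theorem MvPolynomial.IsSymmetric.aeval_mem_range {R S : Type*} [CommRing R] [CommRing S]
    (f : R →+* S) {n : ℕ} (a : Fin n → S)
    (ha : (∏ i, (Polynomial.X - Polynomial.C (a i))) ∈ Polynomial.lifts f)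
    {p : MvPolynomial (Fin n) ℤ} (hp : p.IsSymmetric) : aeval a p ∈ f.range := by
  -- By the fundamental theorem on symmetric polynomials it is enough to treat the elementary ones.
  obtain ⟨q, hq⟩ := MvPolynomial.esymmAlgHom_surjective (σ := Fin n) (n := n) ℤ (by simp) ⟨p, hp⟩
  have hq' : aeval (fun i : Fin n => esymm (Fin n) ℤ (i + 1)) q = p := by
    rw [← MvPolynomial.esymmAlgHom_apply, hq]
  have hc : aeval a (aeval (fun i : Fin n => esymm (Fin n) ℤ (i + 1)) q) =
      aeval (fun i : Fin n => aeval a (esymm (Fin n) ℤ (i + 1))) q := by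
    rw [← AlgHom.comp_apply, comp_aeval]
  rw [← hq', hc]
  have h : ∀ q : MvPolynomial (Fin n) ℤ,
      aeval (fun i : Fin n => aeval a (esymm (Fin n) ℤ (i + 1))) q ∈ f.range := by
    intro q
    induction q using MvPolynomial.induction_on with
    | C z => simp
    | add p q hp hq => rw [map_add]; exact add_mem hp hq
    | mul_X p i hp =>
      rw [map_mul]
      refine mul_mem hp ?_
      rw [aeval_X, MvPolynomial.aeval_esymm_eq_multiset_esymm]
      -- Up to sign, the coefficient of degree n - (i + 1) is the elementary symmetric function of
      -- degree i + 1; the shift is due to `Fin n` starting at 0.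
      have hc := (Polynomial.lifts_iff_coeff_lifts _).mp ha (n - (i + 1))
      have e : ∏ i, (Polynomial.X - Polynomial.C (a i)) =
          ((Finset.univ.val.map a).map fun t => Polynomial.X - Polynomial.C t).prod := by
        rw [Multiset.map_map]; rfl
      have hcard : Multiset.card (Finset.univ.val.map a) = n := by simp
      rw [e, Multiset.prod_X_sub_C_coeff _ (by rw [hcard]; omega), hcard,
        Nat.sub_sub_self (by omega)] at hc
      have hu : ((-1 : S) ^ ((i : ℕ) + 1)) * (-1) ^ ((i : ℕ) + 1) = 1 := by
        rw [← mul_pow]; simp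
      have := mul_mem (pow_mem (neg_mem (one_mem f.range)) ((i : ℕ) + 1)) hc
      rwa [← mul_assoc, hu, one_mul] at this
  exact h q

/-- The coefficients are symmetric integral polynomials in the aᵢ, since a permutation of the
variables permutes the j-element subsets I. As a Witt vector the product is the sum of the [∏_{i ∈
I} aᵢ], that is, the j-th elementary symmetric function of the [aᵢ]. -/
theorem prod_powersetCard_one_sub_mem_lifts {R S : Type*} [CommRing R] [CommRing S]
    (f : R →+* S) {n : ℕ} (a : Fin n → S)
    (ha : (∏ i, (Polynomial.X - Polynomial.C (a i))) ∈ Polynomial.lifts f) (j : ℕ) :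
    (∏ I ∈ Finset.powersetCard j (Finset.univ : Finset (Fin n)),
      (1 - Polynomial.C (∏ i ∈ I, a i) * Polynomial.X)) ∈ Polynomial.lifts f := by
  -- The generic case, with the aᵢ replaced by independent variables, in which symmetry can be
  -- stated.
  let U : (MvPolynomial (Fin n) ℤ)[X] :=
    ∏ I ∈ Finset.powersetCard j (Finset.univ : Finset (Fin n)),
      (1 - Polynomial.C (∏ i ∈ I, MvPolynomial.X i) * Polynomial.X)
  have hU : U.map (MvPolynomial.aeval a : _ →ₐ[ℤ] S).toRingHom =
      ∏ I ∈ Finset.powersetCard j (Finset.univ : Finset (Fin n)),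
        (1 - Polynomial.C (∏ i ∈ I, a i) * Polynomial.X) := by
    simp only [U, Polynomial.map_prod]
    refine Finset.prod_congr rfl fun I _ => ?_
    have e : MvPolynomial.aeval a (∏ i ∈ I, (MvPolynomial.X i : MvPolynomial (Fin n) ℤ)) =
      ∏ i ∈ I, a i := by simp
    simp only [Polynomial.map_sub, Polynomial.map_mul, Polynomial.map_one, Polynomial.map_C,
      Polynomial.map_X]
    rw [← e]
    rfl
  rw [← hU, Polynomial.lifts_iff_coeff_lifts]
  intro m
  rw [Polynomial.coeff_map]
  refine MvPolynomial.IsSymmetric.aeval_mem_range f a ha fun e => ?_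
  have hs : U.map (MvPolynomial.rename e : _ →ₐ[ℤ] _).toRingHom = U := by
    simp only [U, Polynomial.map_prod]
    refine Finset.prod_equiv e.finsetCongr (fun I => by simp [Finset.mem_powersetCard]) fun I _ => ?_
    have e : MvPolynomial.rename e (∏ i ∈ I, (MvPolynomial.X i : MvPolynomial (Fin n) ℤ)) =
      ∏ i ∈ e.finsetCongr I, MvPolynomial.X i := by simp
    simp only [Polynomial.map_sub, Polynomial.map_mul, Polynomial.map_one, Polynomial.map_C,
      Polynomial.map_X]
    rw [← e]
    rfl
  conv_rhs => rw [← hs, Polynomial.coeff_map]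
  rfl

/-- Both maps out of R are injections into domains and S is algebraic over R, so this is the
embedding of an algebraic extension into an algebraically closed field. -/
theorem RingHom.exists_extension_of_injective {R S Ω : Type*} [CommRing R] [CommRing S]
    [IsDomain S] [Field Ω] [IsAlgClosed Ω] {f : R →+* S} (hf : f.IsIntegral)
    (hinj : Function.Injective f) (φ : R →+* Ω) (hφ : Function.Injective φ) :
    ∃ ψ : S →+* Ω, ψ.comp f = φ := by
  have : IsDomain R := hinj.isDomain f
  algebraize [f, φ]
  have : Module.IsTorsionFree R S := Module.isTorsionFree_iff_algebraMap_injective.mpr hinj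
  have : Module.IsTorsionFree R Ω := Module.isTorsionFree_iff_algebraMap_injective.mpr hφ
  have : Algebra.IsIntegral R S := ⟨hf⟩
  let ψ : S →ₐ[R] Ω := IsAlgClosed.lift
  exact ⟨ψ, RingHom.ext fun r => ψ.commutes r⟩

/-- A homomorphism to an algebraically closed field extends along an injective integral
homomorphism. -/
theorem RingHom.exists_extension_of_isIntegral {R S Ω : Type*} [CommRing R] [CommRing S]
    [Field Ω] [IsAlgClosed Ω] {f : R →+* S} (hf : f.IsIntegral) (hinj : Function.Injective f)
    (φ : R →+* Ω) : ∃ ψ : S →+* Ω, ψ.comp f = φ := by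
  have hP : (RingHom.ker φ).IsPrime := RingHom.ker_isPrime φ
  -- Rational Witt rings need not be domains. Lying over provides a prime Q above ker φ; dividing by
  -- both primes reduces to the injective case.
  obtain ⟨Q, hQ, hQ'⟩ : ∃ Q : Ideal S, Q.IsPrime ∧ Q.comap f = RingHom.ker φ := by
    algebraize [f]
    have : Algebra.IsIntegral R S := ⟨hf⟩
    obtain ⟨Q, -, hQ, hQ'⟩ := Ideal.exists_ideal_over_prime_of_isIntegral (S := S)
      (RingHom.ker φ) ⊥ (by
        rw [← RingHom.ker_eq_comap_bot,
          (RingHom.injective_iff_ker_eq_bot (algebraMap R S)).mp hinj]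
        exact bot_le)
    exact ⟨Q, hQ, hQ'⟩
  let g : R ⧸ RingHom.ker φ →+* S ⧸ Q := Ideal.quotientMap Q f hQ'.ge
  have hg : g.IsIntegral := by
    refine RingHom.IsIntegral.tower_top (Ideal.Quotient.mk _) g ?_
    have e : g.comp (Ideal.Quotient.mk _) = (Ideal.Quotient.mk Q).comp f := RingHom.ext fun r => rfl
    rw [e]
    exact hf.trans _ _ (RingHom.isIntegral_of_surjective _ Ideal.Quotient.mk_surjective)
  obtain ⟨ψ, hψ⟩ := RingHom.exists_extension_of_injective hg
    (Ideal.quotientMap_injective' hQ'.le) (RingHom.kerLift φ) (RingHom.kerLift_injective φ)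
  refine ⟨ψ.comp (Ideal.Quotient.mk Q), RingHom.ext fun r => ?_⟩
  exact DFunLike.congr_fun hψ (Ideal.Quotient.mk _ r)

namespace RatWitt

variable {k L : Type u} [Field k] [Field L] [IsAlgClosed L]

/-- Let s₁, …, sₙ be the roots in L of a monic polynomial over k that vanishes at a. Then [a] is a
root of ∏(T - [sᵢ]), and the coefficients of this product come from W_rat(k). -/
theorem isIntegralElem_teichmuller {f : k →+* L} (hf : f.IsIntegral) (a : L) :
    (map f).IsIntegralElem (teichmuller a) := by
  obtain ⟨p, hp, hpa⟩ := hf a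
  have hsplit := (IsAlgClosed.splits (p.map f)).eq_prod_roots_of_monic (hp.map f)
  obtain ⟨n, s, hs⟩ : ∃ (n : ℕ) (s : Fin n → L), (p.map f).roots = Finset.univ.val.map s := by
    refine ⟨_, fun i => (p.map f).roots.toList.get i, ?_⟩
    rw [Fin.univ_val_map, List.ofFn_get, Multiset.coe_toList]
  have hprod : (p.map f) = ∏ i, (Polynomial.X - Polynomial.C (s i)) := by
    rw [hsplit, hs, Multiset.map_map]; rfl
  have hl : (∏ i, (Polynomial.X - Polynomial.C (s i))) ∈ Polynomial.lifts f :=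
    ⟨p, by rw [← hprod]; rfl⟩
  have ha : ∃ i, s i = a := by
    have : a ∈ (p.map f).roots := by
      rw [Polynomial.mem_roots (hp.map f).ne_zero, Polynomial.IsRoot, Polynomial.eval_map, hpa]
    rw [hs] at this
    simpa using this
  have hq : (∏ i, (Polynomial.X - Polynomial.C (teichmuller (s i)))) ∈
      Polynomial.lifts (map f) := by
    have e : ∏ i, (Polynomial.X - Polynomial.C (teichmuller (s i))) =
        ((Finset.univ.val.map (teichmuller ∘ s)).map
          fun t => Polynomial.X - Polynomial.C t).prod := by
      rw [Multiset.map_map]; rfl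
    rw [e, Multiset.prod_X_sub_X_eq_sum_esymm]
    refine sum_mem fun j _ => mul_mem (pow_mem ?_ _) (mul_mem ?_ (pow_mem ?_ _))
    · exact ⟨-1, by simp⟩
    -- The j-th elementary symmetric function of the [sᵢ] is the polynomial ∏(1 - (∏_{i ∈ I} sᵢ)t)
    -- over the j-element sets I, which has coefficients in k.
    · obtain ⟨q, hq⟩ := prod_powersetCard_one_sub_mem_lifts f s hl j
      have e : (∏ I ∈ Finset.powersetCard j (Finset.univ : Finset (Fin n)),
          (1 - Polynomial.C (∏ i ∈ I, s i) * Polynomial.X)) =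
          (((Finset.powersetCard j (Finset.univ : Finset (Fin n))).val.map
            fun I => ∏ i ∈ I, s i).map fun a => 1 - Polynomial.C a * Polynomial.X).prod := by
        rw [Multiset.map_map]; rfl
      rw [e] at hq
      replace hq : q.map f = _ := hq
      have hq0 : q.coeff 0 = 1 := f.injective (by
        rw [← Polynomial.coeff_map, map_one, hq, coeff_zero_prod])
      have : map f (ofPoly q hq0) = (Finset.univ.val.map (teichmuller ∘ s)).esymm j := by
        rw [map_ofPoly, Finset.esymm_map_val, ofPoly_congr hq, ofPoly_multiset_prod,
          Multiset.map_map]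
        refine Finset.sum_congr rfl fun I _ => ?_
        simp
      rw [← this]
      exact Polynomial.C_mem_lifts _ _
    · exact Polynomial.X_mem_lifts _
  obtain ⟨q, hq, -, hqm⟩ := Polynomial.lifts_and_natDegree_eq_and_monic hq
    (Polynomial.monic_prod_of_monic _ _ fun i _ => Polynomial.monic_X_sub_C _)
  refine ⟨q, hqm, ?_⟩
  obtain ⟨i, rfl⟩ := ha
  rw [← Polynomial.eval_map, hq, Polynomial.eval_prod]
  exact Finset.prod_eq_zero (Finset.mem_univ i) (by simp)

theorem map_isIntegral {f : k →+* L} (hf : f.IsIntegral) : (map f).IsIntegral := by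
  intro w
  have h : w ∈ AddSubgroup.closure (Set.range (teichmuller : L → RatWitt L)) := by
    rw [closure_range_teichmuller]; trivial
  induction h using AddSubgroup.closure_induction with
  | mem x hx => obtain ⟨a, rfl⟩ := hx; exact isIntegralElem_teichmuller hf a
  | zero => exact RingHom.isIntegralElem_zero _
  | add x y _ _ hx hy => exact RingHom.IsIntegralElem.add _ hx hy
  | neg x _ hx => exact RingHom.IsIntegralElem.neg _ hx

theorem exists_extension {Ω : Type*} [Field Ω] [IsAlgClosed Ω] {f : k →+* L} (hf : f.IsIntegral)
    (φ : RatWitt k →+* Ω) : ∃ ψ : RatWitt L →+* Ω, ψ.comp (map f) = φ :=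
  RingHom.exists_extension_of_isIntegral (map_isIntegral hf) (map_injective f.injective) φ

end RatWitt

/-! ### Conjugacy of characters under a profinite Galois group -/

/-- Two finite families of monoid homomorphisms with the same sum have the same members. -/
theorem MonoidHom.exists_eq_of_sum_eq {M Ω ι : Type*} [Monoid M] [CommRing Ω] [IsDomain Ω]
    [CharZero Ω] [Fintype ι] {f g : ι → M →* Ω} (h : ∀ m, ∑ i, f i m = ∑ i, g i m) (i : ι) :
    ∃ j, f j = g i := by
  classical
  by_contra! hne
  let c : (M →* Ω) →₀ Ω := ∑ j, Finsupp.single (g j) 1 - ∑ j, Finsupp.single (f j) 1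
  have hc : c = 0 := by
    refine linearIndependent_iff.mp (linearIndependent_monoidHom M Ω) c ?_
    ext m
    simp [c, map_sum, h m]
  -- If `g i` were not among the `f j`, its coefficient in the trivial relation c would be its
  -- multiplicity in the family g: a positive integer, nonzero in characteristic zero.
  have hci := DFunLike.congr_fun hc (g i)
  have h1 : (∑ j, Finsupp.single (f j) (1 : Ω)) (g i) = 0 := by
    rw [Finsupp.finsetSum_apply]
    exact Finset.sum_eq_zero fun j _ => by simp [hne j]
  have h2 : (∑ j, Finsupp.single (g j) (1 : Ω)) (g i) =
      ((Finset.univ.filter fun j => g j = g i).card : Ω) := by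
    rw [Finsupp.finsetSum_apply]
    simp [Finsupp.single_apply]
  simp only [c, Finsupp.coe_sub, Pi.sub_apply, h1, h2, sub_zero, Finsupp.coe_zero, Pi.zero_apply,
    Nat.cast_eq_zero, Finset.card_eq_zero] at hci
  exact Finset.notMem_empty i (hci ▸ (by simp))

section Galois

variable {E K B Ω : Type*} [Field E] [Field K] [Algebra E K] [IsGalois E K] [CommRing B]
  {j : B →+* K} (hj : Function.Injective j) (hB : ∀ (σ : Gal(K/E)) (b : B), ∃ b', j b' = σ (j b))

include hj hB in
-- For j b ∈ L the polynomial ∏ₛ(X - s(j b)) has coefficients in E, so the hypothesis gives Σₛ F∘s =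
-- Σₛ F'∘s on the multiplicative monoid j⁻¹(L). Linear independence of characters then identifies
-- the term s = 1 on the right with some F∘s.
theorem exists_gal_of_sum_eq_of_finite [CommRing Ω] [IsDomain Ω] [CharZero Ω] {F F' : B →* Ω}
    (h : ∀ t : Multiset B, (t.map fun b => Polynomial.X - Polynomial.C (j b)).prod ∈
      Polynomial.lifts (algebraMap E K) → (t.map F).sum = (t.map F').sum)
    (L : IntermediateField E K) [FiniteDimensional E L] [IsGalois E L] :
    ∃ σ : Gal(K/E), ∀ b b', j b ∈ L → j b' = σ (j b) → F' b = F b' := by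
  let M : Submonoid B := L.toSubring.toSubmonoid.comap j
  choose act hact using hB
  have hact' : ∀ (s : Gal(K/E)) (b : B), j b ∈ L → j (act s b) ∈ L := by
    intro s b hb
    rw [hact]
    exact (AlgEquiv.restrictNormal_commutes s L ⟨j b, hb⟩) ▸ Subtype.property _
  -- A set-theoretic section suffices: on elements of L the action of `lift s` depends only on s.
  let lift : Gal(L/E) → Gal(K/E) := Function.surjInv (AlgEquiv.restrictNormalHom_surjective K)
  have hlift : ∀ (s : Gal(L/E)) (x : L), lift s x = s x := by
    intro s x
    have := Function.surjInv_eq (AlgEquiv.restrictNormalHom_surjective K (F := E) (K₁ := L)) s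
    conv_rhs => rw [← this]
    exact (AlgEquiv.restrictNormal_commutes _ L x).symm
  let a : Gal(L/E) → M →* M := fun s =>
    { toFun := fun b => ⟨act (lift s) b, hact' _ _ b.2⟩
      map_one' := Subtype.ext (hj (by simp [hact]))
      map_mul' := fun b c => Subtype.ext (hj (by simp [hact])) }
  have hsum : ∀ b : M, ∑ s, (F.comp (M.subtype.comp (a s))) b =
      ∑ s, (F'.comp (M.subtype.comp (a s))) b := by
    intro b
    have hl := Algebra.IsInvariant.charpoly_mem_lifts E L Gal(L/E) ⟨j b, b.2⟩
    -- One conjugate for each s, with repetitions; this is why the hypothesis speaks of multisets.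
    have := h (Finset.univ.val.map fun s => (a s b : B)) ?_
    · simpa [Multiset.map_map] using! this
    · obtain ⟨p, hp⟩ := hl
      refine ⟨p, ?_⟩
      rw [IsScalarTower.algebraMap_eq E L K, ← Polynomial.mapRingHom_comp, RingHom.comp_apply, hp,
        MulSemiringAction.charpoly_eq, map_prod, Multiset.map_map]
      refine Finset.prod_congr rfl fun s _ => ?_
      simp only [Polynomial.coe_mapRingHom, Polynomial.map_sub, Polynomial.map_X, Polynomial.map_C,
        Function.comp_apply]
      congr 2
      exact ((hact _ _).trans (hlift s ⟨j b, b.2⟩)).symm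
  obtain ⟨s, hs⟩ := MonoidHom.exists_eq_of_sum_eq hsum 1
  refine ⟨lift s, fun b b' hb hb' => ?_⟩
  have h1 := DFunLike.congr_fun hs ⟨b, hb⟩
  have e1 : act (lift s) b = b' := hj (by rw [hact, hb'])
  -- `lift 1` need not be the identity, but it fixes L.
  have e2 : act (lift 1) b = b := hj (by rw [hact]; exact hlift 1 ⟨j b, hb⟩)
  change F (act (lift s) b) = F' (act (lift 1) b) at h1
  rw [← e1, h1, e2]

include hj hB in
-- Compactness of the Krull topology: for each b the condition on σ is closed, and finitely many of
-- them hold simultaneously for some σ, by the finite case for a finite Galois extension containing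
-- the elements j b.
theorem exists_gal_of_sum_eq [CommRing Ω] [IsDomain Ω] [CharZero Ω] {F F' : B →* Ω}
    (h : ∀ t : Multiset B, (t.map fun b => Polynomial.X - Polynomial.C (j b)).prod ∈
      Polynomial.lifts (algebraMap E K) → (t.map F).sum = (t.map F').sum) :
    ∃ σ : Gal(K/E), ∀ b b', j b' = σ (j b) → F' b = F b' := by
  let C : B → Set Gal(K/E) := fun b => {σ | ∀ b', j b' = σ (j b) → F' b = F b'}
  have hC : ∀ b, IsClosed (C b) := by
    intro b
    refine ⟨isOpen_iff_mem_nhds.mpr fun σ hσ => ?_⟩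
    -- The condition depends only on σ(j b), so it is constant on the open coset of the stabilizer
    -- of j b through σ.
    have ho := (stabilizer_isOpen_of_isIntegral (K := E) (j b)).leftCoset σ
    refine Filter.mem_of_superset (ho.mem_nhds ⟨1, one_mem _, mul_one σ⟩) ?_
    rintro _ ⟨τ, hτ, rfl⟩ hs
    refine hσ fun b' hb' => hs b' ?_
    rw [hb']
    change σ (j b) = σ (τ (j b))
    rw [show τ (j b) = j b from hτ]
  obtain ⟨σ, -, hσ⟩ := isCompact_univ.inter_iInter_nonempty C hC fun u => by
    classical
    let L := FiniteGaloisIntermediateField.adjoin E ((u.image j : Finset K) : Set K)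
    obtain ⟨σ, hσ⟩ := exists_gal_of_sum_eq_of_finite hj hB h L.toIntermediateField
    refine ⟨σ, trivial, Set.mem_iInter₂.mpr fun b hb b' hb' => hσ b b' ?_ hb'⟩
    exact FiniteGaloisIntermediateField.subset_adjoin E _ (by simpa using ⟨b, hb, rfl⟩)
  exact ⟨σ, fun b b' hb' => Set.mem_iInter.mp hσ b b' hb'⟩

end Galois

/-! ### Descent from the perfect closure, and conjugacy for normal domains -/

section PurelyInseparable

/-- A polynomial with coefficients in the perfect closure of `k` has a power with coefficients
in `k`. -/
theorem Polynomial.exists_pow_mem_lifts_of_perfectClosure {k K : Type*} [Field k] [Field K]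
    [Algebra k K] {P : K[X]} (hP : P ∈ Polynomial.lifts (algebraMap (perfectClosure k K) K)) :
    ∃ m : ℕ, 0 < m ∧ P ^ m ∈ Polynomial.lifts (algebraMap k K) := by
  -- With the exponential characteristic no case distinction is needed: in characteristic zero q =
  -- 1.
  let q := ringExpChar k
  have hqk : ExpChar k q := ringExpChar.expChar k
  have hq : ExpChar K q := expChar_of_injective_algebraMap (algebraMap k K).injective q
  have hc : ∀ i, ∃ n : ℕ, P.coeff i ^ q ^ n ∈ (algebraMap k K).range := by
    intro i
    obtain ⟨c, hc⟩ := (Polynomial.lifts_iff_coeff_lifts _).mp hP i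
    rw [← hc]
    exact mem_perfectClosure_iff.mp c.2
  choose n hn using hc
  let N := P.support.sup n
  have hN : ∀ i, P.coeff i ^ q ^ N ∈ (algebraMap k K).range := by
    intro i
    by_cases hs : i ∈ P.support
    · obtain ⟨d, hd⟩ := Nat.exists_eq_add_of_le (Finset.le_sup (f := n) hs)
      rw [show N = n i + d from hd, pow_add, pow_mul]
      exact pow_mem (hn _) _
    · rw [Polynomial.notMem_support_iff.mp hs, zero_pow (pow_pos (expChar_pos k q) N).ne']
      exact zero_mem _
  refine ⟨q ^ N, pow_pos (expChar_pos k q) N, ?_⟩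
  -- P to the power q^N is obtained by raising the coefficients to that power and substituting
  -- X^(q^N) for X, so only powers of single coefficients matter.
  rw [← Polynomial.map_iterateFrobenius_expand q P N, Polynomial.lifts_iff_coeff_lifts]
  intro i
  rw [Polynomial.coeff_map, Polynomial.coeff_expand (pow_pos (expChar_pos k q) N)]
  split_ifs with hd
  · exact hN _
  · rw [map_zero]
    exact ⟨0, map_zero _⟩

end PurelyInseparable

namespace RatWitt

/-- If `B` is the integral closure of a normal domain `A` in an algebraic closure of its fraction
field, then two homomorphisms from `W_rat(B)` which agree on `W_rat(A)` are conjugate. -/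
theorem exists_gal_of_comp_map_eq {A B : Type u} {k K Ω : Type*} [CommRing A] [IsDomain A]
    [IsIntegrallyClosed A] [CommRing B] [Field k] [Field K] [Algebra A k] [IsFractionRing A k]
    [Algebra k K] [IsAlgClosure k K] [Algebra A K] [IsScalarTower A k K] [Algebra A B]
    [Algebra B K] [IsScalarTower A B K] [IsIntegralClosure B A K] [CommRing Ω] [IsDomain Ω]
    [CharZero Ω] {F F' : RatWitt B →+* Ω}
    (h : F.comp (map (algebraMap A B)) = F'.comp (map (algebraMap A B))) :
    ∃ σ : Gal(K/k), ∀ b b' : B, algebraMap B K b' = σ (algebraMap B K b) →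
      F' (teichmuller b) = F (teichmuller b') := by
  have := IsAlgClosure.isAlgClosed (R := k) (K := K)
  have := IsAlgClosure.isAlgebraic (R := k) (K := K)
  -- K/k may be inseparable, but K/E is Galois. The σ found over E is restricted to k at the end of
  -- the reduction.
  let E := perfectClosure k K
  have : PerfectField E := inferInstance
  have : Algebra.IsAlgebraic E K := Algebra.IsAlgebraic.tower_top (K := k) E
  have : IsGalois E K := {}
  have hj : Function.Injective (algebraMap B K) := IsIntegralClosure.algebraMap_injective B A K
  have hB : ∀ (σ : Gal(K/E)) (b : B), ∃ b', algebraMap B K b' = σ (algebraMap B K b) := by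
    intro σ b
    have hb : IsIntegral A (algebraMap B K b) := IsIntegralClosure.isIntegral_iff.mpr ⟨b, rfl⟩
    refine IsIntegralClosure.isIntegral_iff (R := A).mp ?_
    obtain ⟨p, hp, hpb⟩ := hb
    refine ⟨p, hp, ?_⟩
    have e : (σ : K →+* K).comp (algebraMap A K) = algebraMap A K := by
      rw [IsScalarTower.algebraMap_eq A k K, IsScalarTower.algebraMap_eq k E K]
      ext a
      exact σ.commutes _
    have := congrArg (σ : K →+* K) hpb
    rw [Polynomial.hom_eval₂, e, map_zero] at this
    exact this
  suffices hs : ∀ t : Multiset B,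
      (t.map fun b => Polynomial.X - Polynomial.C (algebraMap B K b)).prod ∈
        Polynomial.lifts (algebraMap E K) →
      (t.map ((F : RatWitt B →* Ω).comp teichmuller)).sum =
        (t.map ((F' : RatWitt B →* Ω).comp teichmuller)).sum by
    obtain ⟨σ, hσ⟩ := exists_gal_of_sum_eq hj hB hs
    exact ⟨σ.restrictScalars k, hσ⟩
  intro t ht
  -- The reverse of ∏(X - b); as a Witt vector it is the sum of the [b] over t.
  let P : B[X] := (t.map fun a => (1 - Polynomial.C a * Polynomial.X : B[X])).prod
  have hP0 : P.coeff 0 = 1 := coeff_zero_prod t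
  have hPE : P.map (algebraMap B K) ∈ Polynomial.lifts (algebraMap E K) := by
    have e : P.map (algebraMap B K) = ((t.map (algebraMap B K)).map
        fun a => Polynomial.X - Polynomial.C a).prod.reverse := by
      rw [reverse_prod_X_sub_C, Polynomial.map_multiset_prod, Multiset.map_map, Multiset.map_map]
      congr 2
      ext1 a
      simp
    rw [e, Multiset.map_map, Polynomial.lifts_iff_coeff_lifts]
    intro i
    rw [Polynomial.coeff_reverse]
    exact (Polynomial.lifts_iff_coeff_lifts _).mp ht _
  obtain ⟨m, hm, hPm⟩ := Polynomial.exists_pow_mem_lifts_of_perfectClosure hPE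
  -- The coefficients of P^m lie in k and are integral over A because they come from B. Normality of
  -- A puts them in A.
  have hPA : P ^ m ∈ Polynomial.lifts (algebraMap A B) := by
    rw [← Polynomial.map_pow, Polynomial.lifts_iff_coeff_lifts] at hPm
    rw [Polynomial.lifts_iff_coeff_lifts]
    intro i
    obtain ⟨z, hz⟩ := hPm i
    rw [Polynomial.coeff_map] at hz
    have hzi : IsIntegral A z := by
      rw [← isIntegral_algebraMap_iff (algebraMap k K).injective, hz]
      exact IsIntegralClosure.isIntegral_iff.mpr ⟨_, rfl⟩
    obtain ⟨a, rfl⟩ := IsIntegrallyClosed.isIntegral_iff.mp hzi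
    refine ⟨a, hj ?_⟩
    rw [← hz, ← IsScalarTower.algebraMap_apply, ← IsScalarTower.algebraMap_apply]
  obtain ⟨Q, hQ⟩ := hPA
  replace hQ : Q.map (algebraMap A B) = P ^ m := hQ
  have hAB : Function.Injective (algebraMap A B) := by
    have : Function.Injective (algebraMap A K) := by
      rw [IsScalarTower.algebraMap_eq A k K]
      exact (algebraMap k K).injective.comp (IsFractionRing.injective A k)
    rw [IsScalarTower.algebraMap_eq A B K] at this
    exact Function.Injective.of_comp this
  have hQ0 : Q.coeff 0 = 1 := hAB (by
    rw [← Polynomial.coeff_map, hQ, map_one, coeff_zero_pow hP0])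
  have e : map (algebraMap A B) (ofPoly Q hQ0) = m • (t.map teichmuller).sum := by
    rw [map_ofPoly, ofPoly_congr hQ, ofPoly_pow hP0, ofPoly_multiset_prod]
  have h' := DFunLike.congr_fun h (ofPoly Q hQ0)
  rw [RingHom.comp_apply, RingHom.comp_apply, e, map_nsmul, map_nsmul, nsmul_eq_mul,
    nsmul_eq_mul] at h'
  -- The exponent m introduced by inseparability is cancelled in Ω, a domain of characteristic zero.
  have h'' := mul_left_cancel₀ (Nat.cast_ne_zero.mpr hm.ne') h'
  rwa [map_multiset_sum, map_multiset_sum, Multiset.map_map, Multiset.map_map] at h''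

end RatWitt

/-! ### Sections over spec ℂ -/

section SpecComplex

theorem specComplex_eq_pt (s : specComplex.{u}) : s = specComplexPt :=
  Subsingleton.elim (α := PrimeSpectrum (ULift.{u} ℂ)) _ _

theorem specComplexResidue_bijective : Function.Bijective specComplexResidue.{u} := by
  refine ⟨RingHom.injective _, ?_⟩
  refine (ULift.ringEquiv : ULift.{u} ℂ ≃+* ℂ).surjective.comp ?_
  have h : specComplex.{u}.residue specComplexPt ≫
      specComplex.{u}.descResidueField specComplexStalk = specComplexStalk :=
    Scheme.residue_descResidueField _
  intro a
  obtain ⟨b, rfl⟩ := (ConcreteCategory.bijective_of_isIso specComplexStalk.{u}).2 a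
  exact ⟨specComplex.{u}.residue specComplexPt b, ConcreteCategory.congr_hom h b⟩

/-- The value of a section of `O_{spec ℂ}` at the point. -/
def specComplexEval (U : specComplex.{u}.Opens) (h : specComplexPt ∈ U) :
    Γ(specComplex.{u}, U) →+* ℂ :=
  specComplexResidue.comp (specComplex.evaluation U specComplexPt h).hom

theorem specComplexEval_map {U V : specComplex.{u}.Opens} (i : U ⟶ V) (h : specComplexPt ∈ U)
    (a : Γ(specComplex.{u}, V)) :
    specComplexEval U h (specComplex.{u}.presheaf.map i.op a) =
      specComplexEval V (i.le h) a := by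
  have := specComplex.{u}.presheaf.germ_res_apply i specComplexPt h a
  exact congrArg (fun b => specComplexResidue (specComplex.residue specComplexPt b)) this

theorem specComplexEval_bijective (U : specComplex.{u}.Opens) (h : specComplexPt ∈ U) :
    Function.Bijective (specComplexEval U h) := by
  obtain rfl : U = ⊤ := by
    ext s
    simpa [specComplex_eq_pt s] using h
  have e : specComplex.{u}.presheaf.germ ⊤ specComplexPt h ≫ specComplexStalk =
      (Scheme.ΓSpecIso (CommRingCat.of (ULift.{u} ℂ))).hom :=
    germ_stalkClosedPointIso_hom _
  have e' : specComplexEval ⊤ h = (ULift.ringEquiv : ULift.{u} ℂ ≃+* ℂ).toRingHom.comp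
      (Scheme.ΓSpecIso (CommRingCat.of (ULift.{u} ℂ))).hom.hom := by
    rw [← e]
    have h' : specComplex.{u}.residue specComplexPt ≫
      specComplex.{u}.descResidueField specComplexStalk = specComplexStalk :=
      Scheme.residue_descResidueField _
    rw [← h']
    rfl
  rw [e']
  exact (ULift.ringEquiv : ULift.{u} ℂ ≃+* ℂ).bijective.comp
    (ConcreteCategory.bijective_of_isIso (Scheme.ΓSpecIso (CommRingCat.of (ULift.{u} ℂ))).hom)

theorem specComplex_subsingleton_sections (U : specComplex.{u}.Opens) (h : specComplexPt ∉ U) :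
    Subsingleton Γ(specComplex.{u}, U) := by
  obtain rfl : U = ⊥ := by
    ext s
    simpa [specComplex_eq_pt s] using h
  infer_instance

end SpecComplex

/-! ### Maps induced on residue rings -/

namespace ResiduedSpace

theorem comp_eq_comp_of_squares {C : Type*} [Category C] {A B D A' B' D' : C} {a : A ⟶ B}
    {d : D ⟶ A} {b : B ⟶ B'} {c : A ⟶ A'} {r : A' ⟶ B'} {k : D ⟶ D'} {r' : D' ⟶ A'}
    (h : a ≫ b = c ≫ r) (h' : d ≫ c = k ≫ r') : (d ≫ a) ≫ b = k ≫ r' ≫ r := by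
  rw [Category.assoc, h, ← Category.assoc, h', Category.assoc]

theorem Hom.residueMap_comp {S X Y : ResiduedSpace.{u}} (f : S ⟶ X) (g : X ⟶ Y) (s : S.space) :
    (f ≫ g).residueMap s = g.residueMap (f.pt s) ≫ f.residueMap s := by
  refine (Hom.residueMap_unique (f ≫ g) s (g.residueMap (f.pt s) ≫ f.residueMap s) ?_).symm
  have e := PresheafedSpace.stalkMap.comp (Hom.hom f).hom (Hom.hom g).hom s
  have hr : (Hom.hom f).hom.stalkMap s ≫ S.residue s =
      X.residue ((Hom.hom f).hom.base s) ≫ f.residueMap s := f.residue_residueMap s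
  have hr' : (Hom.hom g).hom.stalkMap ((Hom.hom f).hom.base s) ≫
      X.residue ((Hom.hom f).hom.base s) = Y.residue (g.pt (f.pt s)) ≫ g.residueMap (f.pt s) :=
    g.residue_residueMap (f.pt s)
  exact (congrArg (· ≫ S.residue s) e).trans (comp_eq_comp_of_squares hr hr')

end ResiduedSpace

/-- `residueMap` is obtained by choice; uniqueness identifies it with the explicit map, which makes
the same square commute. -/
theorem ratWittMap_residueMap {X Y : Scheme.{u}} (α : Y ⟶ X) (y : Y) :
    (ratWittMap α).residueMap y = ratWittFunctor.map (α.residueFieldMap y) := by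
  refine (ResiduedSpace.Hom.residueMap_unique (ratWittMap α) y
    (ratWittFunctor.map (α.residueFieldMap y)) ?_).symm
  apply ratWittSheaf_stalk_hom_ext
  intro U hx
  have h1 := PresheafedSpace.stalkMap_germ (X := (ratWittSpace Y).space.toPresheafedSpace)
    (Y := (ratWittSpace X).space.toPresheafedSpace) ⟨α.base, ratWittMapC α⟩ U y hx
  have h2 := NatTrans.congr_app (toRatWittSheaf_ratWittMapC α) (op U)
  have h3 := germ_ratWittResidue X (α y) U hx
  have h4 := germ_ratWittResidue Y y (α ⁻¹ᵁ U) hx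
  have h5 := congrArg (fun f => ratWittFunctor.map f) (Scheme.evaluation_naturality α y hx)
  simp only [Functor.map_comp] at h5
  exact residue_compat_aux h1 h2 h3 h4 h5

theorem ratWittFrob_residueMap (X : Scheme.{u}) (ν : ℕ+) (y : X) :
    (ratWittFrob X ν).residueMap y = (ratWittFrobenius ν).app (X.residueField y) := by
  refine (ResiduedSpace.Hom.residueMap_unique (ratWittFrob X ν) y
    ((ratWittFrobenius ν).app (X.residueField y)) ?_).symm
  apply ratWittSheaf_stalk_hom_ext
  intro U hx
  have h1 := PresheafedSpace.stalkMap_germ (X := (ratWittSpace X).space.toPresheafedSpace)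
    (Y := (ratWittSpace X).space.toPresheafedSpace) ⟨𝟙 _, ratWittSheafFrob X ν⟩ U y hx
  have h2 := NatTrans.congr_app (toRatWittSheaf_frob X ν) (op U)
  have h3 := germ_ratWittResidue X y U hx
  have h5 := (ratWittFrobenius ν).naturality (X.evaluation U y hx)
  exact residue_compat_aux h1 h2 h3 h3 h5

namespace RatWitt

variable {R S : Type u} [CommRing R] [CommRing S] {A : Type*} [CommRing A]

/-- The character `Rˣ → Aˣ` induced by a homomorphism `W_rat(R) → A`. -/
def unitsChar (φ : RatWitt R →+* A) : Rˣ →* Aˣ :=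
  Units.map ((φ : RatWitt R →* A).comp teichmuller)

theorem unitsChar_comp_map (f : R →+* S) (φ : RatWitt S →+* A) :
    unitsChar (φ.comp (map f)) = (unitsChar φ).comp (Units.map f.toMonoidHom) :=
  MonoidHom.ext fun a => Units.ext (congrArg φ (map_teichmuller f (a : R)))

theorem unitsChar_comp_frobenius (ν : ℕ+) (φ : RatWitt R →+* A) :
    unitsChar (φ.comp (frobenius ν)) = (unitsChar φ).comp (powMonoidHom (ν : ℕ)) :=
  MonoidHom.ext fun a => Units.ext (congrArg φ (frobenius_teichmuller ν (a : R)))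

end RatWitt

/-- The pairs of a point `x` of a scheme `X` and a ring homomorphism `W_rat(κ(x)) → ℂ`. -/
structure RatWittHomPair (X : Scheme.{u}) : Type u where
  /-- The point. -/
  pt : X
  /-- The homomorphism. -/
  hom : RatWitt (X.residueField pt) →+* ℂ

/-! ### Complex points of W_rat(X) as pairs (x, φ) -/

namespace RatWittHomPair

variable {X Y Z : Scheme.{u}}

/-- The image of a pair under a morphism. -/
def push (f : X ⟶ Y) (p : RatWittHomPair X) : RatWittHomPair Y :=
  ⟨f p.pt, p.hom.comp (RatWitt.map (f.residueFieldMap p.pt).hom)⟩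

theorem push_comp (f : X ⟶ Y) (g : Y ⟶ Z) (p : RatWittHomPair X) :
    push (f ≫ g) p = push g (push f p) := by
  obtain ⟨x, φ⟩ := p
  simp only [push, Scheme.residueFieldMap_comp]
  exact congrArg (mk _) (congrArg φ.comp (RatWitt.map_comp _ _))

/-- The action of the Frobenius endomorphisms. -/
def frob (ν : ℕ+) (p : RatWittHomPair X) : RatWittHomPair X :=
  ⟨p.pt, p.hom.comp (RatWitt.frobenius ν)⟩

/-- The associated character of `κ(x)ˣ`. -/
def toCharPair (p : RatWittHomPair X) : CharPair X :=
  ⟨p.pt, RatWitt.unitsChar p.hom⟩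

theorem toCharPair_push (f : X ⟶ Y) (p : RatWittHomPair X) :
    (push f p).toCharPair = CharPair.push f p.toCharPair :=
  congrArg (CharPair.mk (f p.pt)) (RatWitt.unitsChar_comp_map (f.residueFieldMap p.pt).hom p.hom)

theorem toCharPair_frob (ν : ℕ+) (p : RatWittHomPair X) :
    (frob ν p).toCharPair = ν • p.toCharPair :=
  congrArg (CharPair.mk p.pt) (RatWitt.unitsChar_comp_frobenius ν p.hom)

/-- The pair defined by a complex point of `W_rat(X)`. -/
def ofPoint (P : RatWittPoints X specComplex.{u}) : RatWittHomPair X :=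
  ⟨ResiduedSpace.Hom.pt P specComplexPt,
    specComplexResidue.comp (ResiduedSpace.Hom.residueMap P specComplexPt).hom⟩

theorem ofPoint_map (f : X ⟶ Y) (P : RatWittPoints X specComplex.{u}) :
    ofPoint (P.map f) = push f (ofPoint P) := by
  refine congrArg (mk _) ?_
  have h := (ResiduedSpace.Hom.residueMap_comp P (ratWittMap f) specComplexPt).trans
    (congrArg (· ≫ ResiduedSpace.Hom.residueMap P specComplexPt)
      (ratWittMap_residueMap f (ResiduedSpace.Hom.pt P specComplexPt)))
  exact congrArg (fun r => specComplexResidue.comp (CommRingCat.Hom.hom r)) h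

theorem ofPoint_smul (ν : ℕ+) (P : RatWittPoints X specComplex.{u}) :
    ofPoint (ν • P) = frob ν (ofPoint P) := by
  refine congrArg (mk _) ?_
  have h := (ResiduedSpace.Hom.residueMap_comp P (ratWittFrob X ν) specComplexPt).trans
    (congrArg (· ≫ ResiduedSpace.Hom.residueMap P specComplexPt)
      (ratWittFrob_residueMap X ν (ResiduedSpace.Hom.pt P specComplexPt)))
  exact congrArg (fun r => specComplexResidue.comp (CommRingCat.Hom.hom r)) h

/-- This formula expresses the comorphism of P through its pair alone: the stalk map at the point
factors through φ. It underlies the injectivity of `ofPoint`. -/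
theorem eval_app_eq (P : RatWittPoints X specComplex.{u}) (U : X.Opens)
    (h : (ofPoint P).pt ∈ U) (a : (ratWittSheaf X).obj (op U)) :
    specComplexEval ((Opens.map (ResiduedSpace.Hom.hom P).hom.base).obj U) h
      ((ResiduedSpace.Hom.hom P).hom.c.app (op U) a) =
    (ofPoint P).hom (ratWittResidue X (ofPoint P).pt
      ((ratWittSheaf X).germ U (ofPoint P).pt h a)) := by
  have h1 := PresheafedSpace.stalkMap_germ_apply (ResiduedSpace.Hom.hom P).hom U specComplexPt h a
  have h2 := ConcreteCategory.congr_hom (ResiduedSpace.Hom.residue_residueMap P specComplexPt)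
    ((ratWittSheaf X).germ U (ofPoint P).pt h a)
  refine (congrArg (fun z => specComplexResidue (specComplex.residue specComplexPt z)) h1).symm.trans
    ?_
  exact congrArg specComplexResidue h2

theorem mk_injective {x : X} {φ φ' : RatWitt (X.residueField x) →+* ℂ} (h : mk x φ = mk x φ') :
    φ = φ' :=
  eq_of_heq (mk.inj h).2

/-- A section over spec ℂ is determined by its value at the point, if the open set contains it, and
otherwise lies in the zero ring. So `eval_app_eq` recovers the whole comorphism. -/
theorem ofPoint_injective : Function.Injective (ofPoint (X := X)) := by
  intro P P' e
  have h := eval_app_eq P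
  have h' := eval_app_eq P'
  obtain ⟨⟨⟨b, c⟩⟩, hP⟩ := P
  obtain ⟨⟨⟨b', c'⟩⟩, hP'⟩ := P'
  have hb : b = b' := by
    ext s
    rw [specComplex_eq_pt s]
    exact congrArg pt e
  subst hb
  suffices c = c' by subst this; rfl
  refine NatTrans.ext (funext fun U => ?_)
  induction U using Opposite.rec with | _ U
  ext a
  by_cases hU : b specComplexPt ∈ U
  · refine (specComplexEval_bijective _ hU).1 ((h U hU a).trans (Eq.trans ?_ (h' U hU a).symm))
    exact DFunLike.congr_fun (mk_injective e) _
  · have := specComplex_subsingleton_sections ((Opens.map b).obj U) hU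
    exact Subsingleton.elim (α := Γ(specComplex.{u}, (Opens.map b).obj U)) _ _

/-- The continuous map is constant with value x. Over U ∋ x the comorphism is the germ followed by
the residue map and φ, with values in ℂ = Γ(spec ℂ); over other U the target is the zero ring. -/
theorem ofPoint_surjective : Function.Surjective (ofPoint (X := X)) := by
  classical
  rintro ⟨x, φ⟩
  let b : specComplex.{u}.carrier ⟶ X.carrier := TopCat.ofHom ⟨fun _ => x, continuous_const⟩
  let ev (U : specComplex.{u}.Opens) (h : specComplexPt ∈ U) : Γ(specComplex.{u}, U) ≃+* ℂ :=
    RingEquiv.ofBijective _ (specComplexEval_bijective U h)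
  let val (U : X.Opens) (h : x ∈ U) : (ratWittSheaf X).obj (op U) →+* ℂ :=
    φ.comp ((ratWittSheaf X).germ U x h ≫ ratWittResidue X x).hom
  have hval : ∀ {U V : X.Opens} (i : U ⟶ V) (h : x ∈ U) (a : (ratWittSheaf X).obj (op V)),
      val U h ((ratWittSheaf X).map i.op a) = val V (i.le h) a := by
    intro U V i h a
    exact congrArg (fun z => φ (ratWittResidue X x z))
      ((ratWittSheaf X).germ_res_apply i x h a)
  have hexists : ∀ U : X.Opens, ∃ g : (ratWittSheaf X).obj (op U) →+*
      Γ(specComplex.{u}, (Opens.map b).obj U), ∀ (h : x ∈ U) a,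
        specComplexEval ((Opens.map b).obj U) h (g a) = val U h a := by
    intro U
    by_cases h : x ∈ U
    · exact ⟨(ev ((Opens.map b).obj U) h).symm.toRingHom.comp (val U h), fun _ a =>
        (ev ((Opens.map b).obj U) h).apply_symm_apply _⟩
    · have := specComplex_subsingleton_sections ((Opens.map b).obj U) h
      exact ⟨{ toFun := fun _ => 0
               map_one' := Subsingleton.elim _ _
               map_mul' := fun _ _ => Subsingleton.elim _ _
               map_zero' := rfl
               map_add' := fun _ _ => Subsingleton.elim _ _ }, fun h' => absurd h' h⟩
  choose g hg using hexists
  have hnat : ∀ {U V : X.Opens} (i : U ⟶ V) (a : (ratWittSheaf X).obj (op V)),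
      g U ((ratWittSheaf X).map i.op a) =
        specComplex.{u}.presheaf.map ((Opens.map b).map i).op (g V a) := by
    intro U V i a
    by_cases h : x ∈ U
    · refine (specComplexEval_bijective ((Opens.map b).obj U) h).1 ?_
      rw [hg U h, hval i h, ← hg V (i.le h)]
      exact (specComplexEval_map ((Opens.map b).map i) h (g V a)).symm
    · have := specComplex_subsingleton_sections ((Opens.map b).obj U) h
      exact Subsingleton.elim _ _
  let c : ratWittSheaf X ⟶
      (TopCat.Presheaf.pushforward CommRingCat.{u} b).obj specComplex.{u}.presheaf :=
    { app := fun U => CommRingCat.ofHom (R := (ratWittSheaf X).obj U)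
        (S := Γ(specComplex.{u}, (Opens.map b).obj U.unop)) (g U.unop)
      naturality := fun V U i => CommRingCat.hom_ext (RingHom.ext fun a => hnat i.unop a) }
  let e : specComplex.{u}.residueField specComplexPt ≃+* ℂ :=
    RingEquiv.ofBijective _ specComplexResidue_bijective
  let H : PresheafedSpace.Hom (schemeSpace specComplex.{u}).space.toPresheafedSpace
    (ratWittSpace X).space.toPresheafedSpace := ⟨b, c⟩
  let r : (ratWittSpace X).residueRing x ⟶ (schemeSpace specComplex.{u}).residueRing specComplexPt :=
    CommRingCat.ofHom (e.symm.toRingHom.comp φ)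
  have hr : H.stalkMap specComplexPt ≫ (schemeSpace specComplex.{u}).residue specComplexPt =
      (ratWittSpace X).residue x ≫ r := by
    refine TopCat.Presheaf.stalk_hom_ext (ratWittSheaf X) (x := x) fun U hx => ?_
    ext a
    refine specComplexResidue_bijective.1 ?_
    have h1 := PresheafedSpace.stalkMap_germ_apply H U specComplexPt hx a
    refine (congrArg (fun z => specComplexResidue (specComplex.residue specComplexPt z)) h1).trans ?_
    exact (hg U hx a).trans (e.apply_symm_apply _).symm
  let P : RatWittPoints X specComplex.{u} := ResiduedSpace.Hom.mk (InducedCategory.homMk H) fun s => by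
    obtain rfl := specComplex_eq_pt s
    exact ⟨r, hr⟩
  refine ⟨P, congrArg (mk x) (RingHom.ext fun w => ?_)⟩
  have h := ResiduedSpace.Hom.residueMap_unique P specComplexPt r hr
  have h' := ConcreteCategory.congr_hom h w
  refine (congrArg specComplexResidue h').symm.trans ?_
  exact e.apply_symm_apply _

theorem ofPoint_bijective : Function.Bijective (ofPoint (X := X)) :=
  ⟨ofPoint_injective, ofPoint_surjective⟩

end RatWittHomPair

/-! ### Homomorphisms W_rat(L) → ℂ as characters, and lifting of pairs -/

namespace RatWitt

theorem unitsChar_injective {L : Type u} [Field L] [IsAlgClosed L] {A : Type*} [CommRing A] :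
    Function.Injective (unitsChar : (RatWitt L →+* A) → (Lˣ →* Aˣ)) := by
  intro φ ψ h
  refine ringHom_ext_teichmuller fun a => ?_
  by_cases ha : a = 0
  · rw [ha, teichmuller_zero, map_zero, map_zero]
  · exact congrArg Units.val (DFunLike.congr_fun h (Units.mk0 a ha))

/-- The character is extended by 0 ↦ 0, in accordance with [0] = 0, and then additively to W_rat(L).
-/
theorem unitsChar_surjective {L : Type u} [Field L] [IsAlgClosed L] {A : Type*} [Field A] :
    Function.Surjective (unitsChar : (RatWitt L →+* A) → (Lˣ →* Aˣ)) := by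
  classical
  intro χ
  let h : L →*₀ A :=
    { toFun := fun a => if ha : a = 0 then 0 else χ (Units.mk0 a ha)
      map_zero' := by simp
      map_one' := by simp
      map_mul' := fun a b => by
        by_cases ha : a = 0
        · simp [ha]
        by_cases hb : b = 0
        · simp [hb]
        simp [ha, hb, Units.mk0_mul] }
  refine ⟨ofCharacter h, MonoidHom.ext fun a => Units.ext ?_⟩
  refine (ofCharacter_teichmuller h (a : L)).trans ?_
  simp [h]

end RatWitt

theorem RatWittHomPair.toCharPair_bijective {X : Scheme.{u}}
    (h : ∀ x : X, IsAlgClosed (X.residueField x)) :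
    Function.Bijective (toCharPair (X := X)) := by
  constructor
  · rintro ⟨x, φ⟩ ⟨x', φ'⟩ e
    obtain rfl : x = x' := congrArg CharPair.pt e
    have := h x
    have e' : RatWitt.unitsChar φ = RatWitt.unitsChar φ' := eq_of_heq (CharPair.mk.inj e).2
    exact congrArg (mk x) (RatWitt.unitsChar_injective (L := X.residueField x) e')
  · rintro ⟨x, χ⟩
    have := h x
    obtain ⟨φ, hφ⟩ := RatWitt.unitsChar_surjective (L := X.residueField x) χ
    exact ⟨⟨x, φ⟩, congrArg (CharPair.mk x) hφ⟩

/-- Choose any x over y; integrality of W_rat(κ(y)) → W_rat(κ(x)) extends φ to the larger ring. -/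
theorem RatWittHomPair.exists_push_eq {X Y : Scheme.{u}} {f : X ⟶ Y}
    (hf : Function.Surjective f) (h : ∀ x : X, IsAlgClosed (X.residueField x))
    (hi : ∀ x : X, (f.residueFieldMap x).hom.IsIntegral) :
    Function.Surjective (push f) := by
  rintro ⟨y, φ⟩
  obtain ⟨x, rfl⟩ := hf y
  have := h x
  obtain ⟨ψ, hψ⟩ := RatWitt.exists_extension (k := Y.residueField (f x))
    (L := X.residueField x) (hi x) φ
  exact ⟨⟨x, ψ⟩, congrArg (mk (f x)) hψ⟩

/-! ### Residue fields and points in terms of affine sections -/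

section Fractions

variable {B κ : Type*} [CommRing B] [Field κ] {f : B →+* κ}

theorem exists_common_denominator (hf : ∀ z, ∃ b s, f s ≠ 0 ∧ z * f s = f b) (t : Finset κ) :
    ∃ s, f s ≠ 0 ∧ ∀ z ∈ t, z * f s ∈ f.range := by
  classical
  induction t using Finset.induction_on with
  | empty => exact ⟨1, by simp, by simp⟩
  | insert z t _ ih =>
    obtain ⟨s, hs, hst⟩ := ih
    obtain ⟨b, s', hs', hb⟩ := hf z
    refine ⟨s * s', by simp [hs, hs'], fun y hy => ?_⟩
    rw [map_mul]
    obtain rfl | hy := Finset.mem_insert.mp hy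
    · exact ⟨b * s, by rw [map_mul, ← hb]; ring⟩
    · rw [← mul_assoc]
      exact mul_mem (hst y hy) ⟨s', rfl⟩

/-- If monic polynomials over `B` have roots in `B`, then residue fields of `B` are algebraically
closed. -/
theorem IsAlgClosed.of_exists_root_of_fractions (hf : ∀ z, ∃ b s, f s ≠ 0 ∧ z * f s = f b)
    (hB : ∀ q : B[X], q.Monic → q.natDegree ≠ 0 → ∃ b, q.eval b = 0) : IsAlgClosed κ := by
  refine IsAlgClosed.of_exists_root κ fun p hp hirr => ?_
  obtain ⟨s, hs, hst⟩ := exists_common_denominator hf p.coeffs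
  -- Multiplying the roots by f s multiplies the i-th coefficient by (f s)^(d - i): the polynomial
  -- stays monic, and for i < d at least one factor f s is available to clear the denominator. A
  -- root b of a lift then yields the root f b / f s of p.
  have hl : p.scaleRoots (f s) ∈ Polynomial.lifts f := by
    rw [Polynomial.lifts_iff_coeff_lifts]
    intro i
    rw [Polynomial.coeff_scaleRoots]
    obtain hi | hi | hi := lt_trichotomy i p.natDegree
    · by_cases h0 : p.coeff i = 0
      · exact ⟨0, by simp [h0]⟩
      · obtain ⟨m, hm⟩ := Nat.exists_eq_add_of_lt hi
        rw [show p.natDegree - i = 1 + m by omega, pow_add, pow_one, ← mul_assoc]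
        exact mul_mem (hst _ (Polynomial.coeff_mem_coeffs h0)) (pow_mem (show f s ∈ f.range from ⟨s, rfl⟩) m)
    · rw [hi, hp.coeff_natDegree, Nat.sub_self]
      exact ⟨1, by simp⟩
    · rw [Polynomial.coeff_eq_zero_of_natDegree_lt hi]
      exact ⟨0, by simp⟩
  obtain ⟨q, hq, hqd, hqm⟩ := Polynomial.lifts_and_natDegree_eq_and_monic hl
    ((Polynomial.monic_scaleRoots_iff _).mpr hp)
  obtain ⟨b, hb⟩ := hB q hqm (by
    rw [hqd, Polynomial.natDegree_scaleRoots]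
    exact hirr.natDegree_pos.ne')
  refine ⟨f b / f s, ?_⟩
  have h := Polynomial.scaleRoots_eval_mul p (f b / f s) (f s)
  have e : f s * (f b / f s) = f b := by field_simp
  have h0 : (p.scaleRoots (f s)).eval (f b) = 0 := by
    rw [← hq, Polynomial.eval_map, Polynomial.eval₂_at_apply, hb, map_zero]
  rw [e, h0] at h
  exact (mul_eq_zero.mp h.symm).resolve_left (pow_ne_zero _ hs)

end Fractions

namespace AlgebraicGeometry.IsAffineOpen

variable {X : Scheme.{u}} {V : X.Opens} (hV : IsAffineOpen V)
include hV

theorem exists_evaluation_mul_eq (x : X) (hx : x ∈ V) (z : X.residueField x) :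
    ∃ b s : Γ(X, V), X.evaluation V x hx s ≠ 0 ∧ z * X.evaluation V x hx s =
      X.evaluation V x hx b := by
  obtain ⟨y, rfl⟩ := X.residue_surjective x z
  let := TopCat.Presheaf.algebra_section_stalk X.presheaf (⟨x, hx⟩ : V)
  have := hV.isLocalization_stalk ⟨x, hx⟩
  obtain ⟨⟨b, s⟩, h⟩ := IsLocalization.surj (hV.primeIdealOf ⟨x, hx⟩).asIdeal.primeCompl y
  refine ⟨b, s, ?_, ?_⟩
  · have hs := IsLocalization.map_units (X.presheaf.stalk x) s
    exact (hs.map (X.residue x).hom).ne_zero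
  · have := congrArg (X.residue x).hom h
    rw [map_mul] at this
    exact this

/-- The sections that do not vanish at a point are those whose basic open set contains it. Basic
opens form neighbourhood bases in V, so x and y are inseparable, and the space is T₀. -/
theorem eq_of_evaluation_eq_zero_iff {x y : X} (hx : x ∈ V) (hy : y ∈ V)
    (h : ∀ b, X.evaluation V x hx b = 0 ↔ X.evaluation V y hy b = 0) : x = y := by
  have key : ∀ {x y : X} (hx : x ∈ V) (hy : y ∈ V),
      (∀ b, X.evaluation V x hx b = 0 ↔ X.evaluation V y hy b = 0) →
      ∀ W : Set X, IsOpen W → x ∈ W → y ∈ W := by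
    intro x y hx hy h W hW hxW
    obtain ⟨b, hb, hxb⟩ := hV.exists_basicOpen_le (V := ⟨W, hW⟩) ⟨x, hxW⟩ hx
    refine hb ?_
    rw [← X.evaluation_ne_zero_iff_mem_basicOpen _ hy] 
    rw [← X.evaluation_ne_zero_iff_mem_basicOpen _ hx] at hxb
    exact fun h0 => hxb ((h b).mpr h0)
  refine Inseparable.eq (inseparable_iff_forall_isOpen.mpr fun W hW => ⟨?_, ?_⟩)
  · exact key hx hy h W hW
  · exact key hy hx (fun b => (h b).symm) W hW

end AlgebraicGeometry.IsAffineOpen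

namespace RatWittHomPair

variable {X Y : Scheme.{u}}

/-- The homomorphism `W_rat(O(V)) → W_rat(κ(x)) → ℂ` for an open neighbourhood `V` of `x`. -/
def onSections (p : RatWittHomPair X) (V : X.Opens) (h : p.pt ∈ V) : RatWitt Γ(X, V) →+* ℂ :=
  p.hom.comp (RatWitt.map (X.evaluation V p.pt h).hom)

theorem onSections_push (f : X ⟶ Y) (p : RatWittHomPair X) (U : Y.Opens) (h : f p.pt ∈ U) :
    (p.push f).onSections U h = (p.onSections (f ⁻¹ᵁ U) h).comp (RatWitt.map (f.app U).hom) := by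
  have e := congrArg CommRingCat.Hom.hom (Scheme.evaluation_naturality f p.pt h)
  have e' := congrArg (fun g => p.hom.comp (RatWitt.map g)) e
  simp only [CommRingCat.hom_comp, RatWitt.map_comp] at e'
  exact e'

theorem onSections_teichmuller (p : RatWittHomPair X) (V : X.Opens) (h : p.pt ∈ V) (b : Γ(X, V)) :
    p.onSections V h (RatWitt.teichmuller b) =
      p.hom (RatWitt.teichmuller (X.evaluation V p.pt h b)) :=
  congrArg p.hom (RatWitt.map_teichmuller (X.evaluation V p.pt h).hom b)

/-- For a ≠ 0 the element [a] is a unit. Thus the values of a homomorphism on Teichmüller elements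
of sections detect where these sections vanish. -/
theorem hom_teichmuller_eq_zero_iff (p : RatWittHomPair X) (a : X.residueField p.pt) :
    p.hom (RatWitt.teichmuller a) = 0 ↔ a = 0 := by
  constructor
  · intro h
    by_contra ha
    exact ((isUnit_iff_ne_zero.mpr ha).map
      ((p.hom : RatWitt (X.residueField p.pt) →* ℂ).comp RatWitt.teichmuller)).ne_zero h
  · rintro rfl
    rw [RatWitt.teichmuller_zero, map_zero]

/-- The zeros of b ↦ φ([b]) determine the point, and the values determine the character because
every element of κ(x) is a quotient b/s of values of sections. -/
theorem toCharPair_eq_of_onSections_eq {V : X.Opens} (hV : IsAffineOpen V)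
    {p p' : RatWittHomPair X} (h : p.pt ∈ V) (h' : p'.pt ∈ V)
    (heq : ∀ b, p.onSections V h (RatWitt.teichmuller b) =
      p'.onSections V h' (RatWitt.teichmuller b)) : p.toCharPair = p'.toCharPair := by
  simp only [onSections_teichmuller] at heq
  obtain ⟨x, φ⟩ := p
  obtain ⟨x', φ'⟩ := p'
  obtain rfl : x = x' := hV.eq_of_evaluation_eq_zero_iff h h' fun b => by
    rw [← hom_teichmuller_eq_zero_iff ⟨x, φ⟩, ← hom_teichmuller_eq_zero_iff ⟨x', φ'⟩]
    exact Eq.congr (heq b) rfl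
  refine congrArg (CharPair.mk x) (MonoidHom.ext fun u => Units.ext ?_)
  obtain ⟨b, s, hs, hb⟩ := hV.exists_evaluation_mul_eq x h (u : X.residueField x)
  have hs' := mt (hom_teichmuller_eq_zero_iff ⟨x, φ⟩ (X.evaluation V x h s)).mp hs
  refine mul_right_cancel₀ hs' ?_
  have e1 : φ (RatWitt.teichmuller (u : X.residueField x)) *
      φ (RatWitt.teichmuller (X.evaluation V x h s)) =
      φ (RatWitt.teichmuller (X.evaluation V x h b)) := by
    rw [← map_mul, ← map_mul, hb]
  have e2 : φ' (RatWitt.teichmuller (u : X.residueField x)) *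
      φ' (RatWitt.teichmuller (X.evaluation V x h s)) =
      φ' (RatWitt.teichmuller (X.evaluation V x h b)) := by
    rw [← map_mul, ← map_mul, hb]
  have hb' : φ (RatWitt.teichmuller (X.evaluation V x h b)) =
    φ' (RatWitt.teichmuller (X.evaluation V x h b)) := heq b
  have hs'' : φ (RatWitt.teichmuller (X.evaluation V x h s)) =
    φ' (RatWitt.teichmuller (X.evaluation V x h s)) := heq s
  refine e1.trans (hb'.trans (e2.symm.trans ?_))
  exact congrArg (φ' (RatWitt.teichmuller (u : X.residueField x)) * ·) hs''.symm

end RatWittHomPair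

/-- Being integrally closed can be checked at maximal ideals, where the localizations are stalks of
X. -/
theorem AlgebraicGeometry.IsAffineOpen.isIntegrallyClosed {X : Scheme.{u}} [IsIntegral X]
    (hX : ∀ x : X, IsIntegrallyClosed (X.presheaf.stalk x)) {U : X.Opens} (hU : IsAffineOpen U)
    [Nonempty U] : IsIntegrallyClosed Γ(X, U) := by
  refine IsIntegrallyClosed.of_localization_maximal fun p _ _ => ?_
  have hp : p.IsPrime := inferInstance
  let y : PrimeSpectrum Γ(X, U) := ⟨p, hp⟩
  have hy : hU.fromSpec y ∈ U := by
    have : hU.fromSpec y ∈ Set.range hU.fromSpec := ⟨y, rfl⟩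
    rwa [hU.range_fromSpec] at this
  let := TopCat.Presheaf.algebra_section_stalk X.presheaf (⟨hU.fromSpec y, hy⟩ : U)
  have : IsLocalization.AtPrime (X.presheaf.stalk (hU.fromSpec y)) p := hU.isLocalization_stalk' y hy
  have := hX (hU.fromSpec y)
  exact IsIntegrallyClosed.of_equiv
    (IsLocalization.algEquiv p.primeCompl (X.presheaf.stalk (hU.fromSpec y))
      (Localization.AtPrime p)).toRingEquiv

theorem AlgebraicGeometry.Scheme.Hom.appLE_congr_hom {X Y : Scheme.{u}} {f g : X ⟶ Y} (h : f = g)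
    {U : Y.Opens} {V : X.Opens} (e : V ≤ f ⁻¹ᵁ U) : f.appLE U V e = g.appLE U V (h ▸ e) := by
  subst h; rfl

theorem AlgebraicGeometry.Scheme.specMap_appLE_top {R S : CommRingCat.{u}} (f : R ⟶ S)
    (h : ⊤ ≤ Spec.map f ⁻¹ᵁ ⊤) :
    (Spec.map f).appLE ⊤ ⊤ h ≫ (Scheme.ΓSpecIso S).hom = (Scheme.ΓSpecIso R).hom ≫ f := by
  rw [← Scheme.ΓSpecIso_naturality]
  exact congrArg (· ≫ (Scheme.ΓSpecIso S).hom) (Scheme.Hom.appLE_eq_app _)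

theorem AlgebraicGeometry.Scheme.specMap_fromSpecStalk_appLE {X : Scheme.{u}} {x : X}
    {R : CommRingCat.{u}} (f : X.presheaf.stalk x ⟶ R) {U : X.Opens} (hx : x ∈ U)
    (h : ⊤ ≤ (Spec.map f ≫ X.fromSpecStalk x) ⁻¹ᵁ U) :
    (Spec.map f ≫ X.fromSpecStalk x).appLE U ⊤ h ≫ (Scheme.ΓSpecIso R).hom =
      X.presheaf.germ U x hx ≫ f := by
  have h' : ⊤ ≤ Spec.map f ⁻¹ᵁ X.fromSpecStalk x ⁻¹ᵁ U := h
  have e : (X.fromSpecStalk x).app U ≫ (Spec.map f).appLE _ ⊤ h' ≫ (Scheme.ΓSpecIso R).hom =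
      X.presheaf.germ U x hx ≫ f := by
    rw [Scheme.fromSpecStalk_app hx]
    simp only [Category.assoc]
    rw [Scheme.Hom.map_appLE_assoc, Scheme.specMap_appLE_top, Iso.inv_hom_id_assoc]
  rw [Scheme.Hom.comp_appLE, Category.assoc]
  exact e

/-! ### Sections of the normalization as the integral closure in K -/

section Normalization

variable (X : Scheme.{u}) [IsIntegral X] (K : Type u) [Field K] [Algebra X.functionField K]

/-- The point of `spec K`. -/
def specPt : Spec (CommRingCat.of K) := IsLocalRing.closedPoint K

theorem specToScheme_apply (s : Spec (CommRingCat.of K)) :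
    specToScheme X K s = genericPoint X := by
  rw [specToScheme, Scheme.Hom.comp_apply]
  have e : Spec.map (CommRingCat.ofHom (algebraMap X.functionField K)) s =
      IsLocalRing.closedPoint (X.presheaf.stalk (genericPoint X)) :=
    Subsingleton.elim (α := PrimeSpectrum X.functionField) _ _
  rw [e]
  exact Scheme.fromSpecStalk_closedPoint

theorem genericPoint_mem (U : X.Opens) [h : Nonempty U] : genericPoint X ∈ U :=
  ((genericPoint_spec X).mem_open_set_iff U.isOpen).mpr (by simpa using h)

theorem top_le_specToScheme_preimage (U : X.Opens) [Nonempty U] : ⊤ ≤ specToScheme X K ⁻¹ᵁ U := by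
  intro s _
  change specToScheme X K s ∈ U
  rw [specToScheme_apply]
  exact genericPoint_mem X U

variable {X} in
theorem normalizationIn_top_le (U : X.Opens) [Nonempty U] :
    ⊤ ≤ (specToScheme X K).toNormalization ⁻¹ᵁ (specToScheme X K).fromNormalization ⁻¹ᵁ U := by
  rw [← Scheme.Hom.comp_preimage, Scheme.Hom.toNormalization_fromNormalization]
  exact top_le_specToScheme_preimage X K U

variable {X} in
/-- The embedding into `K` of the sections of the normalization. -/
def normalizationToField (U : X.Opens) [Nonempty U] :
    Γ(normalizationIn X K, (specToScheme X K).fromNormalization ⁻¹ᵁ U) ⟶ CommRingCat.of K :=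
  (specToScheme X K).toNormalization.appLE _ ⊤ (normalizationIn_top_le K U) ≫
    (Scheme.ΓSpecIso (CommRingCat.of K)).hom

variable {X} in
-- Compatibility of the embedding with Γ(X, U) → K₀ → K; it provides the scalar tower needed to
-- speak of the integral closure in K.
theorem app_normalizationToField (U : X.Opens) [Nonempty U] :
    (specToScheme X K).fromNormalization.app U ≫ normalizationToField K U =
      X.germToFunctionField U ≫ CommRingCat.ofHom (algebraMap X.functionField K) := by
  have h := (specToScheme X K).toNormalization.appLE_comp_appLE
    (specToScheme X K).fromNormalization U _ ⊤ le_rfl (normalizationIn_top_le K U)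
  rw [Scheme.Hom.appLE_congr_hom (Scheme.Hom.toNormalization_fromNormalization _)] at h
  rw [normalizationToField, ← Category.assoc, Scheme.Hom.app_eq_appLE, h]
  exact Scheme.specMap_fromSpecStalk_appLE _ (genericPoint_mem X U) _

theorem Scheme.map_top_bijective {Y : Scheme.{u}} (V : Y.Opens) (h : ⊤ ≤ V) :
    Function.Bijective (Y.presheaf.map (homOfLE h).op) := by
  obtain rfl := top_le_iff.mp h
  have : homOfLE h = 𝟙 _ := rfl
  rw [this, op_id, Y.presheaf.map_id]
  exact Function.bijective_id

variable {X} in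
-- Over an affine U the embedding is the inclusion of the integral closure used in the construction
-- of the normalization. Its injectivity and its image are read off from this.
theorem normalizationToField_eq {U : X.Opens} (hU : IsAffineOpen U) [Nonempty U] :
    letI := ((specToScheme X K).app U).hom.toAlgebra
    normalizationToField K U = ((specToScheme X K).normalizationObjIso hU).hom ≫
      CommRingCat.ofHom (integralClosure Γ(X, U)
        Γ(Spec (CommRingCat.of K), specToScheme X K ⁻¹ᵁ U)).val.toRingHom ≫
      (Spec (CommRingCat.of K)).presheaf.map (homOfLE (top_le_specToScheme_preimage X K U)).op ≫
      (Scheme.ΓSpecIso (CommRingCat.of K)).hom := by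
  rw [← Category.assoc, (specToScheme X K).normalizationObjIso_hom_val hU, ← Category.assoc,
    Scheme.Hom.appLE_map]
  rfl

section Affine

variable {X} {U : X.Opens} (hU : IsAffineOpen U) [Nonempty U]

/-- The embedding into `K` of the integral closure of `Γ(X, U)` in `K`. -/
theorem sectionsToField_bijective :
    Function.Bijective ((Spec (CommRingCat.of K)).presheaf.map
      (homOfLE (top_le_specToScheme_preimage X K U)).op ≫
      (Scheme.ΓSpecIso (CommRingCat.of K)).hom).hom :=
  (ConcreteCategory.bijective_of_isIso (Scheme.ΓSpecIso (CommRingCat.of K)).hom).comp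
    (Scheme.map_top_bijective _ _)

include hU

theorem normalizationToField_injective : Function.Injective (normalizationToField K U).hom := by
  rw [normalizationToField_eq K hU]
  let := ((specToScheme X K).app U).hom.toAlgebra
  have h1 := (sectionsToField_bijective K (U := U)).1
  have h2 := (ConcreteCategory.bijective_of_isIso ((specToScheme X K).normalizationObjIso hU).hom).1
  exact h1.comp (Subtype.val_injective.comp h2)

theorem isIntegralElem_iff_mem_range (z : K) :
    ((X.germToFunctionField U ≫ CommRingCat.ofHom (algebraMap X.functionField K)).hom.IsIntegralElem
      z) ↔ ∃ b, (normalizationToField K U).hom b = z := by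
  have hr : X.germToFunctionField U ≫ CommRingCat.ofHom (algebraMap X.functionField K) =
      (specToScheme X K).app U ≫ (Spec (CommRingCat.of K)).presheaf.map
      (homOfLE (top_le_specToScheme_preimage X K U)).op ≫
      (Scheme.ΓSpecIso (CommRingCat.of K)).hom := by
    rw [← app_normalizationToField, normalizationToField_eq K hU,
      Scheme.Hom.fromNormalization_app _ hU, Category.assoc, Iso.inv_hom_id_assoc]
    rfl
  rw [normalizationToField_eq K hU, hr]
  let := ((specToScheme X K).app U).hom.toAlgebra
  have hbij := sectionsToField_bijective K (U := U)
  -- The normalization is built from the integral closure in Γ(spec K, f⁻¹U) rather than in K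
  -- itself, so integrality is transported along the isomorphism of the two.
  obtain ⟨w, rfl⟩ := hbij.2 z
  constructor
  · rintro ⟨p, hp, hpw⟩
    have hw : IsIntegral Γ(X, U) w := by
      refine ⟨p, hp, hbij.1 ?_⟩
      rw [Polynomial.hom_eval₂, map_zero]
      exact hpw
    obtain ⟨b, hb⟩ := (ConcreteCategory.bijective_of_isIso
      ((specToScheme X K).normalizationObjIso hU).hom).2 ⟨w, hw⟩
    refine ⟨b, ?_⟩
    exact congrArg (fun y => ((Spec (CommRingCat.of K)).presheaf.map
      (homOfLE (top_le_specToScheme_preimage X K U)).op ≫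
      (Scheme.ΓSpecIso (CommRingCat.of K)).hom).hom (Subtype.val y)) hb
  · rintro ⟨b, hb⟩
    let y := ((specToScheme X K).normalizationObjIso hU).hom b
    have hy : y.1 = w := hbij.1 hb
    obtain ⟨p, hp, hpw⟩ := y.2
    rw [hy] at hpw
    refine ⟨p, hp, ?_⟩
    have := congrArg ((Spec (CommRingCat.of K)).presheaf.map
      (homOfLE (top_le_specToScheme_preimage X K U)).op ≫
      (Scheme.ΓSpecIso (CommRingCat.of K)).hom).hom hpw
    rw [Polynomial.hom_eval₂, map_zero] at this
    exact this

end Affine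

end Normalization

/-- An integral morphism induces algebraic extensions of residue fields. -/
theorem AlgebraicGeometry.IsIntegralHom.residueFieldMap_isIntegral {X Y : Scheme.{u}} (f : X ⟶ Y)
    [IsIntegralHom f] (x : X) : (f.residueFieldMap x).hom.IsIntegral := by
  obtain ⟨_, ⟨U, hU, rfl⟩, hxU, -⟩ := Y.isBasis_affineOpens.exists_subset_of_mem_open
    (Set.mem_univ (f x)) isOpen_univ
  have hsec : ∀ b : Γ(X, f ⁻¹ᵁ U), (f.residueFieldMap x).hom.IsIntegralElem
      (X.evaluation (f ⁻¹ᵁ U) x hxU b) := by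
    intro b
    obtain ⟨p, hp, hpb⟩ := f.isIntegral_app U hU b
    refine ⟨p.map (Y.evaluation U (f x) hxU).hom, hp.map _, ?_⟩
    have e := congrArg CommRingCat.Hom.hom (Scheme.evaluation_naturality f x hxU)
    rw [CommRingCat.hom_comp, CommRingCat.hom_comp] at e
    have h := congrArg (X.evaluation (f ⁻¹ᵁ U) x hxU).hom hpb
    rw [Polynomial.hom_eval₂, map_zero, ← e] at h
    rw [Polynomial.eval₂_map]
    exact h
  intro z
  -- z is a quotient of values of sections, and those values are integral over the residue field
  -- below.
  obtain ⟨b, s, hs, hz⟩ := (hU.preimage f).exists_evaluation_mul_eq x hxU z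
  algebraize [(f.residueFieldMap x).hom]
  have hb' : _root_.IsIntegral (Y.residueField (f x)) (X.evaluation (f ⁻¹ᵁ U) x hxU b) := hsec b
  have hs' : _root_.IsIntegral (Y.residueField (f x)) (X.evaluation (f ⁻¹ᵁ U) x hxU s) := hsec s
  have e : z = X.evaluation (f ⁻¹ᵁ U) x hxU b * (X.evaluation (f ⁻¹ᵁ U) x hxU s)⁻¹ := by
    rw [← hz, mul_assoc, mul_inv_cancel₀ hs, mul_one]
  rw [e]
  exact hb'.mul hs'.inv

theorem RingHom.IsIntegralElem.of_comp_of_isIntegral {A B C : Type*} [CommRing A] [CommRing B]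
    [CommRing C] {f : A →+* B} {g : B →+* C} (hf : f.IsIntegral) {z : C}
    (hz : g.IsIntegralElem z) : (g.comp f).IsIntegralElem z := by
  algebraize [f, g, g.comp f]
  exact isIntegral_trans (R := A) (A := B) z hz

/-! ### Geometry of the normalization and the Galois action -/

section Normalization

variable (X : Scheme.{u}) [IsIntegral X] (K : Type u) [Field K] [Algebra X.functionField K]

/-- A monic polynomial over the sections above an affine U has a root in K. By transitivity the root
is integral over Γ(X, U), so it is again a section. This property passes to residue fields by
clearing denominators. -/
theorem normalizationIn_isAlgClosed_residueField [IsAlgClosed K] (x : normalizationIn X K) :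
    IsAlgClosed ((normalizationIn X K).residueField x) := by
  let π := (specToScheme X K).fromNormalization
  obtain ⟨_, ⟨U, hU, rfl⟩, hxU, -⟩ := X.isBasis_affineOpens.exists_subset_of_mem_open
    (Set.mem_univ (π x)) isOpen_univ
  have : Nonempty U := ⟨⟨π x, hxU⟩⟩
  refine IsAlgClosed.of_exists_root_of_fractions
    ((hU.preimage π).exists_evaluation_mul_eq x hxU) fun q hq hq0 => ?_
  have hj := normalizationToField_injective K hU
  obtain ⟨β, hβ⟩ := IsAlgClosed.exists_root (q.map (normalizationToField K U).hom) (by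
    refine Polynomial.degree_ne_of_natDegree_ne ?_
    rw [hq.natDegree_map]
    exact hq0)
  have hint : (X.germToFunctionField U ≫
      CommRingCat.ofHom (algebraMap X.functionField K)).hom.IsIntegralElem β := by
    rw [← app_normalizationToField]
    exact RingHom.IsIntegralElem.of_comp_of_isIntegral (π.isIntegral_app U hU) ⟨q, hq, by
      rwa [Polynomial.IsRoot, Polynomial.eval_map] at hβ⟩
  obtain ⟨b, rfl⟩ := (isIntegralElem_iff_mem_range K hU β).mp hint
  refine ⟨b, hj ?_⟩
  rw [Polynomial.IsRoot, Polynomial.eval_map, Polynomial.eval₂_at_apply] at hβ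
  rw [hβ, map_zero]

/-- The image is closed, as π is integral, and contains the generic point. -/
theorem fromNormalization_surjective :
    Function.Surjective (specToScheme X K).fromNormalization := by
  let π := (specToScheme X K).fromNormalization
  have hc : IsClosed (Set.range π) := π.isClosedMap.isClosed_range
  have hg : genericPoint X ∈ Set.range π := by
    refine ⟨(specToScheme X K).toNormalization (specPt K), ?_⟩
    rw [← Scheme.Hom.comp_apply, Scheme.Hom.toNormalization_fromNormalization, specToScheme_apply]
  intro y
  exact (genericPoint_spec X).specializes (Set.mem_univ y) |>.mem_closed hc hg

variable {X K}

/-- Inside K, the geometric automorphism `galHom` acts on sections by σ itself; this links the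
conjugacy result for rings to the action on pairs. -/
theorem galHom_appLE_normalizationToField (σ : Gal(K/X.functionField)) (U : X.Opens) [Nonempty U]
    (h : (specToScheme X K).fromNormalization ⁻¹ᵁ U ≤
      galHom X σ ⁻¹ᵁ (specToScheme X K).fromNormalization ⁻¹ᵁ U) :
    (galHom X σ).appLE _ _ h ≫ normalizationToField K U =
      normalizationToField K U ≫ CommRingCat.ofHom (σ : K →+* K) := by
  have h1 := (specToScheme X K).toNormalization.appLE_comp_appLE (galHom X σ) _ _ ⊤ h
    (normalizationIn_top_le K U)
  rw [Scheme.Hom.appLE_congr_hom (toNormalization_galHom X σ)] at h1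
  have hle : ⊤ ≤ Spec.map (CommRingCat.ofHom (σ : K →+* K)) ⁻¹ᵁ ⊤ := le_top
  have h2 := (Spec.map (CommRingCat.ofHom (σ : K →+* K))).appLE_comp_appLE
    (specToScheme X K).toNormalization _ ⊤ ⊤ (normalizationIn_top_le K U) hle
  have h3 := Scheme.specMap_appLE_top (CommRingCat.ofHom (σ : K →+* K)) hle
  rw [normalizationToField, ← Category.assoc, h1, ← h2, Category.assoc, Category.assoc, h3]

theorem galHom_preimage (σ : Gal(K/X.functionField)) (U : X.Opens) :
    galHom X σ ⁻¹ᵁ (specToScheme X K).fromNormalization ⁻¹ᵁ U =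
      (specToScheme X K).fromNormalization ⁻¹ᵁ U := by
  rw [← Scheme.Hom.comp_preimage, galHom_fromNormalization]

end Normalization

/-! ### Fibres of the map to X as Galois orbits -/

namespace RatWittHomPair

variable {X : Scheme.{u}} [IsIntegral X] {K : Type u} [Field K] [Algebra X.functionField K]

theorem onSections_push_appLE {Y Z : Scheme.{u}} (f : Y ⟶ Z) (p : RatWittHomPair Y) (V : Y.Opens)
    (W : Z.Opens) (h : V ≤ f ⁻¹ᵁ W) (hp : p.pt ∈ V) (b : Γ(Z, W)) :
    (p.push f).onSections W (h hp) (RatWitt.teichmuller b) =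
      p.onSections V hp (RatWitt.teichmuller (f.appLE W V h b)) := by
  refine (DFunLike.congr_fun (onSections_push f p W (h hp)) _).trans ?_
  rw [RingHom.comp_apply, RatWitt.map_teichmuller, onSections_teichmuller, onSections_teichmuller]
  have := Y.presheaf.germ_res_apply (homOfLE h) p.pt hp (f.app W b)
  exact congrArg (fun z => p.hom (RatWitt.teichmuller (Y.residue p.pt z))) this.symm

theorem onSections_congr {Y : Scheme.{u}} {p p' : RatWittHomPair Y} (e : p = p') (V : Y.Opens)
    (h : p.pt ∈ V) (h' : p'.pt ∈ V) : p.onSections V h = p'.onSections V h' := by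
  subst e; rfl

/-- Two pairs on the normalization with the same image are conjugate. -/
theorem exists_gal_of_push_eq (hX : ∀ x : X, IsIntegrallyClosed (X.presheaf.stalk x))
    [IsAlgClosure X.functionField K] {p p' : RatWittHomPair (normalizationIn X K)}
    (h : p.push (specToScheme X K).fromNormalization =
      p'.push (specToScheme X K).fromNormalization) :
    ∃ σ : Gal(K/X.functionField), p'.toCharPair = p.toCharPair.push (galHom X σ) := by
  let π := (specToScheme X K).fromNormalization
  obtain ⟨_, ⟨U, hU, rfl⟩, hpU, -⟩ := X.isBasis_affineOpens.exists_subset_of_mem_open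
    (Set.mem_univ (π p.pt)) isOpen_univ
  have hne : Nonempty U := ⟨⟨π p.pt, hpU⟩⟩
  have hpU' : π p'.pt ∈ U := by
    rw [show π p'.pt = π p.pt from (congrArg pt h).symm]
    exact hpU
  have hA := hU.isIntegrallyClosed hX
  have hfrac := functionField_isFractionRing_of_isAffineOpen X U hU
  have hUV : ∀ q : RatWittHomPair (normalizationIn X K), π q.pt ∈ U → q.pt ∈ π ⁻¹ᵁ U := fun _ h => h
  let F := p.onSections (π ⁻¹ᵁ U) hpU
  let F' := p'.onSections (π ⁻¹ᵁ U) hpU'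
  -- Both composites are the homomorphism on W_rat(Γ(X, U)) given by the common image of p and p'.
  have hF : F.comp (RatWitt.map (π.app U).hom) = F'.comp (RatWitt.map (π.app U).hom) := by
    rw [← onSections_push, ← onSections_push]
    exact onSections_congr h U _ _
  let : Algebra Γ(X, U) K := ((algebraMap X.functionField K).comp
    (X.germToFunctionField U).hom).toAlgebra
  let : Algebra Γ(X, U) Γ(normalizationIn X K, π ⁻¹ᵁ U) := (π.app U).hom.toAlgebra
  let : Algebra Γ(normalizationIn X K, π ⁻¹ᵁ U) K := (normalizationToField K U).hom.toAlgebra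
  have : IsScalarTower Γ(X, U) X.functionField K := .of_algebraMap_eq' rfl
  have : IsScalarTower Γ(X, U) Γ(normalizationIn X K, π ⁻¹ᵁ U) K := .of_algebraMap_eq'
    (congrArg CommRingCat.Hom.hom (app_normalizationToField K U)).symm
  have : IsIntegralClosure Γ(normalizationIn X K, π ⁻¹ᵁ U) Γ(X, U) K :=
    ⟨normalizationToField_injective K hU, fun {z} => isIntegralElem_iff_mem_range K hU z⟩
  obtain ⟨σ, hσ⟩ := RatWitt.exists_gal_of_comp_map_eq (A := Γ(X, U)) (k := X.functionField)
    (K := K) hF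
  refine ⟨σ, ?_⟩
  rw [← toCharPair_push]
  have hg := (galHom_preimage σ U).ge
  -- Pairs are compared through Teichmüller elements of sections over π⁻¹U, where pushing p along
  -- `galHom` replaces b by σ(b).
  refine toCharPair_eq_of_onSections_eq (hU.preimage π) (hUV p' hpU') (hg (hUV p hpU)) fun b => ?_
  rw [onSections_push_appLE (galHom X σ) p (π ⁻¹ᵁ U) (π ⁻¹ᵁ U) hg (hUV p hpU)]
  refine hσ b _ ?_
  exact ConcreteCategory.congr_hom (galHom_appLE_normalizationToField σ U hg) b

end RatWittHomPair

namespace RatWittHomPair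

theorem push_frob {X Y : Scheme.{u}} (f : X ⟶ Y) (ν : ℕ+) (p : RatWittHomPair X) :
    push f (frob ν p) = frob ν (push f p) := by
  refine congrArg (mk (f p.pt)) ?_
  have h := RatWitt.map_comp_frobenius (f.residueFieldMap p.pt).hom ν
  exact (congrArg p.hom.comp h).symm

end RatWittHomPair

/-! ### The bijection -/

namespace RatWittPoints

theorem map_smul {X Y : Scheme.{u}} (f : X ⟶ Y) (ν : ℕ+) (P : RatWittPoints X specComplex.{u}) :
    (ν • P).map f = ν • P.map f := by
  apply RatWittHomPair.ofPoint_injective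
  rw [RatWittHomPair.ofPoint_map, RatWittHomPair.ofPoint_smul, RatWittHomPair.push_frob,
    RatWittHomPair.ofPoint_smul, RatWittHomPair.ofPoint_map]

end RatWittPoints

theorem CharPair.ofPoint_bijective {X : Scheme.{u}}
    (h : ∀ x : X, IsAlgClosed (X.residueField x)) :
    Function.Bijective (CharPair.ofPoint : RatWittPoints X specComplex.{u} → CharPair X) :=
  (RatWittHomPair.toCharPair_bijective h).comp RatWittHomPair.ofPoint_bijective

section Normalization

variable (X : Scheme.{u}) [IsIntegral X] (K : Type u) [Field K] [Algebra X.functionField K]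

theorem RatWittPoints.map_fromNormalization_surjective [IsAlgClosed K] :
    Function.Surjective fun Q : RatWittPoints (normalizationIn X K) specComplex.{u} =>
      Q.map (specToScheme X K).fromNormalization := by
  intro P
  obtain ⟨q, hq⟩ := RatWittHomPair.exists_push_eq (fromNormalization_surjective X K)
    (normalizationIn_isAlgClosed_residueField X K)
    (IsIntegralHom.residueFieldMap_isIntegral _) (RatWittHomPair.ofPoint P)
  obtain ⟨Q, rfl⟩ := RatWittHomPair.ofPoint_surjective q
  refine ⟨Q, RatWittHomPair.ofPoint_injective ?_⟩
  rw [RatWittHomPair.ofPoint_map, hq]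

theorem RatWittPoints.map_fromNormalization_eq_iff [IsAlgClosure X.functionField K]
    (hX : ∀ x : X, IsIntegrallyClosed (X.presheaf.stalk x))
    (Q Q' : RatWittPoints (normalizationIn X K) specComplex.{u}) :
    Q.map (specToScheme X K).fromNormalization = Q'.map (specToScheme X K).fromNormalization ↔
      CharOrbit.mk X K (CharPair.ofPoint Q) = CharOrbit.mk X K (CharPair.ofPoint Q') := by
  have : IsAlgClosed K := IsAlgClosure.isAlgClosed X.functionField
  rw [← RatWittHomPair.ofPoint_injective.eq_iff, RatWittHomPair.ofPoint_map,
    RatWittHomPair.ofPoint_map]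
  have hmk : CharOrbit.mk X K (CharPair.ofPoint Q) = CharOrbit.mk X K (CharPair.ofPoint Q') ↔
      ∃ σ : (Gal(K/X.functionField))ᵐᵒᵖ, σ • CharPair.ofPoint Q' = CharPair.ofPoint Q :=
    Quotient.eq
  rw [hmk]
  constructor
  · intro h
    obtain ⟨σ, hσ⟩ := RatWittHomPair.exists_gal_of_push_eq hX h.symm
    exact ⟨.op σ, hσ.symm⟩
  · rintro ⟨σ, hσ⟩
    have e : RatWittHomPair.ofPoint Q = (RatWittHomPair.ofPoint Q').push (galHom X σ.unop) := by
      -- Orbits are formed from characters, and on the normalization a character determines its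
      -- homomorphism.
      apply (RatWittHomPair.toCharPair_bijective
        (normalizationIn_isAlgClosed_residueField X K)).1
      rw [RatWittHomPair.toCharPair_push]
      exact hσ.symm
    rw [e, ← RatWittHomPair.push_comp, galHom_fromNormalization]

end Normalization

theorem theorem4p1 (X₀ : Scheme.{u}) [IsIntegral X₀]
    (hX₀ : ∀ x : X₀, IsIntegrallyClosed (X₀.presheaf.stalk x))
    (K : Type u) [Field K] [Algebra X₀.functionField K] [IsAlgClosure X₀.functionField K] :
    Function.Bijective (CharPair.ofPoint :
      RatWittPoints (normalizationIn X₀ K) specComplex.{u} → CharPair (normalizationIn X₀ K)) ∧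
    ∃ Φ : RatWittPoints X₀ specComplex.{u} ≃ CharOrbit X₀ K,
      (∀ (ν : ℕ+) (P : RatWittPoints X₀ specComplex.{u}), Φ (ν • P) = ν • Φ P) ∧
      ∀ Q : RatWittPoints (normalizationIn X₀ K) specComplex.{u},
        Φ (Q.map (specToScheme X₀ K).fromNormalization) = CharOrbit.mk X₀ K (CharPair.ofPoint Q) := by
  have : IsAlgClosed K := IsAlgClosure.isAlgClosed X₀.functionField
  have hbij := CharPair.ofPoint_bijective (normalizationIn_isAlgClosed_residueField X₀ K)
  refine ⟨hbij, ?_⟩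
  have hsurj := RatWittPoints.map_fromNormalization_surjective X₀ K
  have hiff := RatWittPoints.map_fromNormalization_eq_iff X₀ K hX₀
  -- Φ(P) is the orbit of ε of any lift of P. Independence of the lift and injectivity of Φ are the
  -- two directions of `hiff`; bijectivity of ε gives surjectivity.
  choose q hq using hsurj
  let Φ : RatWittPoints X₀ specComplex.{u} → CharOrbit X₀ K :=
    fun P => CharOrbit.mk X₀ K (CharPair.ofPoint (q P))
  have hΦ : ∀ Q : RatWittPoints (normalizationIn X₀ K) specComplex.{u},
      Φ (Q.map (specToScheme X₀ K).fromNormalization) = CharOrbit.mk X₀ K (CharPair.ofPoint Q) :=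
    fun Q => (hiff _ _).mp (hq _)
  have hΦ_bij : Function.Bijective Φ := by
    constructor
    · intro P P' h
      exact (hq P).symm.trans (((hiff _ _).mpr h).trans (hq P'))
    · rintro ⟨p⟩
      obtain ⟨Q, rfl⟩ := hbij.2 p
      exact ⟨_, hΦ Q⟩
  refine ⟨Equiv.ofBijective Φ hΦ_bij, fun ν P => ?_, hΦ⟩
  change Φ (ν • P) = ν • Φ P
  -- As π commutes with the Frobenius, ν • q P is a lift of ν • P, and ε is equivariant.
  conv_lhs => rw [← hq P]
  refine (congrArg Φ (RatWittPoints.map_smul _ ν (q P)).symm).trans ((hΦ _).trans ?_)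
  have e : CharPair.ofPoint (ν • q P) = ν • CharPair.ofPoint (q P) :=
    (congrArg RatWittHomPair.toCharPair (RatWittHomPair.ofPoint_smul ν (q P))).trans
      (RatWittHomPair.toCharPair_frob ν _)
  rw [e]
  rfl

end
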